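/- Let $\tfrac12<H<1$, $T>0$, and let $\{B_\gamma\}_{\gamma\in I}$, $|I|<\infty$, be independent fractional Brownian motions with Hurst parameter $H$ (centered Gaussian processes with a.s. continuous paths and covariance $\tfrac12(s^{2H}+t^{2H}-|t-s|^{2H})$). For a path $f$ put $\|f\|_{\beta,T}=\sup_{0\le c<d\le T}\|f(d)-f(c)\|_2/|d-c|^{\beta}$, and let $B^H=(B_\gamma)_{\gamma\in I}$ be the $\mathbb R^{|I|}$-valued process. Let $U_\gamma:\mathbb R^n\to\mathbb R^n$ ($\gamma\in I$) be differentiable vector fields and $M_\gamma,M^{(1)}_\gamma,M^{(2)}_\gamma$ constants such that for all $x,y\in\mathbb R^n$ and all $i,j$ $$|U^i_\gamma(x)|\le M_\gamma,\qquad |U^i_\gamma(x)-U^i_\gamma(y)|\le M^{(1)}_\gamma\|x-y\|_2,\qquad |\partial_jU^i_\gamma(x)-\partial_jU^i_\gamma(y)|\le M^{(2)}_\gamma\|x-y\|_2 .$$ Let $\alpha=1-H+\delta$, $\beta=H-\varepsilon$ with $1-H<\alpha<\tfrac12$ and $\delta>\varepsilon>0$. Let $\Phi_t$ be the flow on $[0,T]$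 of $$\Phi_t(x)=x+\sum_{\gamma\in I}\int_0^tU_\gamma(\Phi_s(x))\,dB_\gamma(s),\qquad x\in\mathbb R^n,$$ that is, almost surely, for every $x$ the path $t\mapsto\Phi_t(x)$ is Hölder continuous of order $1-\alpha$ on $[0,T]$ and solves this equation, where the integrals are Zähle's pathwise generalized Stieltjes integrals $$\int_a^bf\,dg=(-1)^\alpha\int_a^bD^\alpha_{a+}f(x)\,D^{1-\alpha}_{b-}g_{b-}(x)\,dx,\qquad g_{b-}=g-g(b-),$$ with the left- and right-sided Weyl derivatives $D^\alpha_{a+}$, $D^{1-\alpha}_{b-}$. Let $M$ be an embedded $C^2$ $m$-dimensional submanifold of $\mathbb R^n$ ($m\le n$), $M_t=\Phi_t(M)$, and let $\mathcal H_m$ be $m$-dimensional Hausdorff measure. Then there are a constant $c_1>0$ and a real random variable $C_{1,T}\ge0$ such that, almost surely, $$\sup_{t\in[0,T]}\mathcal H_m(M_t)\le c_1\,\mathcal H_m(M)\,2^{C_{1,T}T}.$$ Here $C_{1,T}$ is a measurable function of the Hölder norms $(\|B_\gamma\|_{\beta,T})_{\gamma\in I}$, this function and $c_1$ depending only on $\alpha,\beta,n,|I|$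 and $\{M_\gamma,M^{(1)}_\gamma,M^{(2)}_\gamma\}_{\gamma\in I}$. Moreover $(C_{1,T})^\beta$ and $\|B^H\|_{\beta,T}$ are integrable and $$E\big[(C_{1,T})^{\beta}\big]\le C_1\,E\big[\|B^H\|_{\beta,T}\big],$$ with a constant $C_1$ depending only on $\alpha,\beta,n,|I|$ and $\{M_\gamma,M^{(1)}_\gamma,M^{(2)}_\gamma\}_{\gamma\in I}$. -/

import Mathlib

open MeasureTheory ProbabilityTheory Set
open scoped NNReal ENNReal

noncomputable section

/-- The Hölder norm `‖f‖_{lam,a,b} = sup_{a ≤ c ≤ d ≤ b} ‖f d - f c‖ / |d - c| ^ lam`. -/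
def holderNorm {E : Type*} [NormedAddCommGroup E] (lam a b : ℝ) (f : ℝ → E) : ℝ :=
  sSup {r : ℝ | ∃ c d : ℝ, a ≤ c ∧ c ≤ d ∧ d ≤ b ∧ r = ‖f d - f c‖ / |d - c| ^ lam}

/-- Left-sided Weyl (Riemann-Liouville) derivative `D^alpha_{a+} f` at `x > a`. -/
def leftWeylDeriv (alpha a : ℝ) (f : ℝ → ℝ) (x : ℝ) : ℝ :=
  (Real.Gamma (1 - alpha))⁻¹ *
    (f x / (x - a) ^ alpha + alpha * ∫ y in a..x, (f x - f y) / (x - y) ^ (1 + alpha))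

/-- Right-sided Weyl (Riemann-Liouville) derivative of order `alpha` at `x < b`, without its
unimodular factor: `D^alpha_{b-} f = (-1) ^ alpha * rightWeylDeriv alpha b f`, where
`(-1) ^ alpha = exp (i * π * alpha)`. -/
def rightWeylDeriv (alpha b : ℝ) (f : ℝ → ℝ) (x : ℝ) : ℝ :=
  (Real.Gamma (1 - alpha))⁻¹ *
    (f x / (b - x) ^ alpha + alpha * ∫ y in x..b, (f x - f y) / (y - x) ^ (1 + alpha))

/-- Zähle's generalized Stieltjes integral
`∫_a^b f dg = (-1) ^ alpha * ∫_a^b D^alpha_{a+} f (x) * D^{1-alpha}_{b-} g_{b-} (x) dx`,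
where `g_{b-} = g - g(b-)`. The two unimodular factors multiply to
`(-1) ^ alpha * (-1) ^ (1 - alpha) = -1`, so everything is real. -/
def genStieltjesIntegral (alpha : ℝ) (f g : ℝ → ℝ) (a b : ℝ) : ℝ :=
  -∫ x in a..b,
    leftWeylDeriv alpha a f x *
      rightWeylDeriv (1 - alpha) b (fun y => g y - Function.leftLim g b) x

/-- `X` (restricted to times `t ≥ 0`) is a fractional Brownian motion with Hurst parameter `H`:
a centered Gaussian process with covariance `(s^{2H} + t^{2H} - |t - s|^{2H}) / 2` and almost
surely continuous paths. -/
structure IsFractionalBrownianMotion {Ω : Type*} [MeasurableSpace Ω] (H : ℝ) (X : ℝ → Ω → ℝ)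
    (P : Measure Ω) : Prop where
  gaussian : IsGaussianProcess (fun (t : ℝ≥0) ω => X t ω) P
  mean_zero : ∀ t : ℝ, 0 ≤ t → ∫ ω, X t ω ∂P = 0
  covariance_eq : ∀ s t : ℝ, 0 ≤ s → 0 ≤ t →
    covariance (X s) (X t) P = (s ^ (2 * H) + t ^ (2 * H) - |t - s| ^ (2 * H)) / 2
  continuous_paths : ∀ᵐ ω ∂P, ContinuousOn (fun t => X t ω) (Ici 0)

/-- Regularity of a finite family of vector fields on `ℝⁿ`: componentwise bound `M0`, Lipschitz
constant `M1` of the components, and Lipschitz constant `M2` of the entries of the Jacobian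
matrix. -/
structure VectorFieldBounds {n k : ℕ}
    (U : Fin k → EuclideanSpace ℝ (Fin n) → EuclideanSpace ℝ (Fin n))
    (M0 M1 M2 : Fin k → ℝ) : Prop where
  bounded : ∀ γ x i, |U γ x i| ≤ M0 γ
  lipschitz : ∀ γ x y i, |U γ x i - U γ y i| ≤ M1 γ * ‖x - y‖
  differentiable : ∀ γ, Differentiable ℝ (U γ)
  deriv_lipschitz : ∀ γ x y i j,
    |fderiv ℝ (U γ) x (EuclideanSpace.single j 1) i -
      fderiv ℝ (U γ) y (EuclideanSpace.single j 1) i| ≤ M2 γ * ‖x - y‖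

/-- `Φ` is, on `[0, T]`, the flow of the integral equation
`Φ_t(x) = x + ∑_γ ∫_0^t U_γ(Φ_s(x)) db_γ(s)` driven by the (deterministic) paths `b_γ`: every
trajectory `t ↦ Φ_t(x)` is Hölder continuous of order `1 - alpha` and solves the equation, the
integrals being generalized Stieltjes integrals. -/
structure IsDrivenFlow {n k : ℕ} (alpha T : ℝ)
    (U : Fin k → EuclideanSpace ℝ (Fin n) → EuclideanSpace ℝ (Fin n))
    (b : Fin k → ℝ → ℝ)
    (Φ : ℝ → EuclideanSpace ℝ (Fin n) → EuclideanSpace ℝ (Fin n)) : Prop where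
  holder : ∀ x, ∃ C : ℝ, ∀ s ∈ Icc 0 T, ∀ t ∈ Icc 0 T,
    ‖Φ t x - Φ s x‖ ≤ C * |t - s| ^ (1 - alpha)
  equation : ∀ x, ∀ t ∈ Icc 0 T, ∀ i,
    Φ t x i = x i + ∑ γ, genStieltjesIntegral alpha (fun s => U γ (Φ s x) i) (b γ) 0 t

/-- `M` is an (embedded) `C²` submanifold of `ℝⁿ` of dimension `m ≤ n`: near each of its points a
`C²` diffeomorphism between open subsets of `ℝⁿ` maps `M` onto an open piece of the coordinate
subspace `ℝᵐ × {0}`. -/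
def IsC2Submanifold {n : ℕ} (m : ℕ) (M : Set (EuclideanSpace ℝ (Fin n))) : Prop :=
  m ≤ n ∧ ∀ x ∈ M,
    ∃ e : OpenPartialHomeomorph (EuclideanSpace ℝ (Fin n)) (EuclideanSpace ℝ (Fin n)),
      x ∈ e.source ∧ ContDiffOn ℝ 2 e e.source ∧ ContDiffOn ℝ 2 e.symm e.target ∧
        e '' (M ∩ e.source) = e.target ∩ {y | ∀ i : Fin n, m ≤ (i : ℕ) → y i = 0}

end

section

open Filter Topology

/-! ### Power kernels -/

/-! The growth bound is pathwise. Let `L` be the sum of the `beta`-Hölder norms of the drivers. Each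
`Φ_t` is Lipschitz with constant `2 ^ N`, where `N ≤ T * (Q * L) ^ (1 / beta) + 2`, and a Lipschitz
map multiplies `m`-dimensional Hausdorff measure by at most the `m`-th power of its constant. Hence
`C_{1,T} = n * (Q * L) ^ (1 / beta)`, whose power `beta` is linear in `L`; the moment bound then
reduces to integrability of Hölder norms.

The analytic tool is the Young-Loève estimate `abs_genStieltjesIntegral_sub_le`: the integral over
`[a, b]` differs from `f a * (g b - g a)` by at most a constant times `K * L * (b - a) ^ (lam +
beta)`. For `f a = 0` it follows from size bounds on the Weyl derivatives. The general case, like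
additivity and linearity, is an identity for `C¹` functions (Fubini and the Beta integral) carried
to the limit along averages with the same Hölder constants.

On an interval of length `Δ` with `L * Δ ^ beta` small, this estimate improves any Hölder constant
`K` of a solution to `a + K / 2`, hence to `2 * a` (`le_two_mul_of_contraction`). The same scheme
applied to the difference of two solutions, with the four-point inequality controlling `U (X) - U
(Y)`, shows that their distance at most doubles on such an interval
(`IsDrivenPath.norm_sub_le_two_mul`). Cutting `[0, T]` into `N` pieces gives `2 ^ N`.

On the probabilistic side, dyadic chaining with Gaussian moments dominates each Hölder norm by an
integrable variable, and a supremum over rational times makes the norm measurable. -/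

lemma intervalIntegrable_sub_rpow_left {r : ℝ} (hr : -1 < r) (x a b : ℝ) :
    IntervalIntegrable (fun y => (y - x) ^ r) volume a b := by
  have := (intervalIntegral.intervalIntegrable_rpow' (a := a - x) (b := b - x) hr).comp_sub_right x
  simpa using this

lemma integral_sub_rpow_left {r : ℝ} (hr : -1 < r) (x b : ℝ) :
    ∫ y in x..b, (y - x) ^ r = (b - x) ^ (r + 1) / (r + 1) := by
  have h1 := intervalIntegral.integral_comp_sub_right (a := x) (b := b) (fun y : ℝ => y ^ r) x
  rw [h1, integral_rpow (Or.inl hr), sub_self, Real.zero_rpow (by linarith), sub_zero]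

/-- Weyl derivative estimates require points strictly inside the interval, while interval integrals
run over `Ioc`; the right endpoint is a null set. -/
lemma ae_mem_Ioc_imp_of_Ioo {p : ℝ → Prop} {a b : ℝ} (h : ∀ x ∈ Ioo a b, p x) :
    ∀ᵐ x : ℝ, x ∈ Ioc a b → p x := by
  have hb : ∀ᵐ x : ℝ, x ≠ b := by simp [ae_iff]
  filter_upwards [hb] with x hx hm
  exact h x ⟨hm.1, lt_of_le_of_ne hm.2 hx⟩

/-! ### Weyl derivatives of Hölder functions -/

lemma continuous_of_holder {K lam : ℝ} (hlam : 0 < lam) {f : ℝ → ℝ}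
    (hf : ∀ x y, |f x - f y| ≤ K * |x - y| ^ lam) : Continuous f := by
  rw [continuous_iff_continuousAt]
  intro x
  rw [ContinuousAt, tendsto_iff_dist_tendsto_zero]
  have h : Tendsto (fun y => K * |y - x| ^ lam) (𝓝 x) (𝓝 0) := by
    have : ContinuousAt (fun y => K * |y - x| ^ lam) x := by
      apply ContinuousAt.mul continuousAt_const
      apply ContinuousAt.rpow_const (by fun_prop) (Or.inr hlam.le)
    have h2 := this.tendsto
    simpa [Real.zero_rpow hlam.ne'] using h2
  refine squeeze_zero (fun _ => dist_nonneg) (fun y => ?_) h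
  rw [Real.dist_eq]; exact hf y x

/-- Reflection in the origin transfers every result on right derivatives to left ones. -/
lemma leftWeylDeriv_eq_rightWeylDeriv (r a : ℝ) (f : ℝ → ℝ) (x : ℝ) :
    leftWeylDeriv r a f x = rightWeylDeriv r (-a) (fun y => f (-y)) (-x) := by
  have h := intervalIntegral.integral_comp_neg (a := a) (b := x)
    (fun y => (f x - f (-y)) / (y + x) ^ (1 + r))
  simp only [neg_neg] at h
  unfold leftWeylDeriv rightWeylDeriv
  simp only [neg_neg, sub_neg_eq_add]
  rw [← h]
  simp only [neg_add_eq_sub]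

lemma abs_weyl_integrand_le {r mu L : ℝ} {h : ℝ → ℝ}
    (hh : ∀ x y, |h x - h y| ≤ L * |x - y| ^ mu) {x y : ℝ} (hxy : x < y) :
    |(h x - h y) / (y - x) ^ (1 + r)| ≤ L * (y - x) ^ (mu - (1 + r)) := by
  have hp : 0 < y - x := sub_pos.2 hxy
  rw [abs_div, abs_of_pos (Real.rpow_pos_of_pos hp _), Real.rpow_sub hp, ← mul_div_assoc]
  have := hh x y
  rw [abs_sub_comm x y, abs_of_pos hp] at this
  gcongr

/-- The Hölder bound turns the kernel into `(y - x) ^ (mu - r - 1)`, integrable because `r < mu`.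
Comparing `h x` with `h b` isolates the only singular term, which carries the factor `h b`. -/
lemma abs_rightWeylDeriv_le {r mu L : ℝ} (hr : 0 < r) (hr1 : r < 1) (hmu : r < mu) {h : ℝ → ℝ}
    (hh : ∀ x y, |h x - h y| ≤ L * |x - y| ^ mu) {x b : ℝ} (hxb : x < b) :
    |rightWeylDeriv r b h x| ≤ (Real.Gamma (1 - r))⁻¹ *
      (|h b| * (b - x) ^ (-r) + (1 + r / (mu - r)) * L * (b - x) ^ (mu - r)) := by
  have hp : 0 < b - x := sub_pos.2 hxb
  have hG : 0 < Real.Gamma (1 - r) := Real.Gamma_pos_of_pos (by linarith)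
  have h1 : |∫ y in x..b, (h x - h y) / (y - x) ^ (1 + r)| ≤ L * ((b - x) ^ (mu - r) / (mu - r)) := by
    have := intervalIntegral.norm_integral_le_of_norm_le (μ := volume) hxb.le
      (f := fun y => (h x - h y) / (y - x) ^ (1 + r))
      (g := fun y => L * (y - x) ^ (mu - (1 + r)))
      (ae_of_all _ fun y hy => abs_weyl_integrand_le hh hy.1)
      ((intervalIntegrable_sub_rpow_left (by linarith) x x b).const_mul L)
    rw [intervalIntegral.integral_const_mul, integral_sub_rpow_left (by linarith)] at this
    rwa [Real.norm_eq_abs, show mu - (1 + r) + 1 = mu - r by ring] at this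
  have h2 : |h x / (b - x) ^ r| ≤ |h b| * (b - x) ^ (-r) + L * (b - x) ^ (mu - r) := by
    rw [abs_div, abs_of_pos (Real.rpow_pos_of_pos hp _), Real.rpow_neg hp.le, Real.rpow_sub hp,
      ← div_eq_mul_inv, ← mul_div_assoc, ← add_div]
    have := hh x b
    rw [abs_sub_comm x b, abs_of_pos hp] at this
    have h3 : |h x| ≤ |h b| + L * (b - x) ^ mu := by
      have := abs_sub_abs_le_abs_sub (h x) (h b); linarith
    gcongr
  unfold rightWeylDeriv
  rw [abs_mul, abs_of_pos (inv_pos.2 hG)]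
  gcongr
  refine (abs_add_le _ _).trans ?_
  rw [abs_mul, abs_of_pos hr]
  have h4 := mul_le_mul_of_nonneg_left h1 hr.le
  have h5 : r * (L * ((b - x) ^ (mu - r) / (mu - r))) = r / (mu - r) * L * (b - x) ^ (mu - r) := by
    field_simp
  rw [h5] at h4
  linarith

lemma holder_comp_neg {L mu : ℝ} {h : ℝ → ℝ} (hh : ∀ x y, |h x - h y| ≤ L * |x - y| ^ mu) (x y : ℝ) :
    |h (-x) - h (-y)| ≤ L * |x - y| ^ mu := by
  have := hh (-x) (-y)
  rwa [show -x - -y = -(x - y) by ring, abs_neg] at this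

lemma abs_leftWeylDeriv_le {r mu L : ℝ} (hr : 0 < r) (hr1 : r < 1) (hmu : r < mu) {h : ℝ → ℝ}
    (hh : ∀ x y, |h x - h y| ≤ L * |x - y| ^ mu) {x a : ℝ} (hax : a < x) :
    |leftWeylDeriv r a h x| ≤ (Real.Gamma (1 - r))⁻¹ *
      (|h a| * (x - a) ^ (-r) + (1 + r / (mu - r)) * L * (x - a) ^ (mu - r)) := by
  rw [leftWeylDeriv_eq_rightWeylDeriv]
  have := abs_rightWeylDeriv_le (x := -x) (b := -a) hr hr1 hmu (holder_comp_neg hh) (by linarith)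
  simpa only [neg_neg, neg_sub_neg] using this

lemma tendsto_rightWeylDeriv {r mu L : ℝ} (hmu : r < mu) (hmu0 : 0 < mu)
    {h : ℝ → ℝ} {u : ℕ → ℝ → ℝ} (hu : ∀ n x y, |u n x - u n y| ≤ L * |x - y| ^ mu)
    (hlim : ∀ x, Tendsto (fun n => u n x) atTop (𝓝 (h x))) {x b : ℝ} (hxb : x < b) :
    Tendsto (fun n => rightWeylDeriv r b (u n) x) atTop (𝓝 (rightWeylDeriv r b h x)) := by
  unfold rightWeylDeriv
  refine Tendsto.const_mul _ (((hlim x).div_const _).add (Tendsto.const_mul _ ?_))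
  apply intervalIntegral.tendsto_integral_filter_of_dominated_convergence
    (fun y => L * (y - x) ^ (mu - (1 + r)))
  · refine Eventually.of_forall fun n => ?_
    have := (continuous_of_holder hmu0 (hu n)).measurable
    exact Measurable.aestronglyMeasurable (by fun_prop)
  · refine Eventually.of_forall fun n => ae_of_all _ fun y hy => ?_
    rw [uIoc_of_le hxb.le] at hy
    exact abs_weyl_integrand_le (hu n) hy.1
  · exact (intervalIntegrable_sub_rpow_left (by linarith) x x b).const_mul L
  · exact ae_of_all _ fun y _ => ((hlim x).sub (hlim y)).div_const _

lemma tendsto_leftWeylDeriv {r mu L : ℝ} (hmu : r < mu) (hmu0 : 0 < mu)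
    {h : ℝ → ℝ} {u : ℕ → ℝ → ℝ} (hu : ∀ n x y, |u n x - u n y| ≤ L * |x - y| ^ mu)
    (hlim : ∀ x, Tendsto (fun n => u n x) atTop (𝓝 (h x))) {x a : ℝ} (hax : a < x) :
    Tendsto (fun n => leftWeylDeriv r a (u n) x) atTop (𝓝 (leftWeylDeriv r a h x)) := by
  simp only [leftWeylDeriv_eq_rightWeylDeriv]
  exact tendsto_rightWeylDeriv hmu hmu0 (fun n => holder_comp_neg (hu n)) (fun y => hlim (-y))
    (by linarith)

/-- An indicator absorbs the moving endpoint, leaving a parametric integral of a jointly measurable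
function. The restriction to `Iic b` avoids reversed orientation. -/
lemma aestronglyMeasurable_integral_right {k : ℝ → ℝ → ℝ} (hk : Measurable (Function.uncurry k))
    (b : ℝ) : AEStronglyMeasurable (fun x => ∫ y in x..b, k x y) (volume.restrict (Iic b)) := by
  have h1 : StronglyMeasurable (fun x => ∫ y, (Ioc x b).indicator (k x) y) := by
    apply StronglyMeasurable.integral_prod_right
    have hs : MeasurableSet {p : ℝ × ℝ | p.1 < p.2 ∧ p.2 ≤ b} :=
      (measurableSet_lt measurable_fst measurable_snd).inter
        (measurableSet_le measurable_snd measurable_const)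
    have := (hk.indicator hs).stronglyMeasurable
    convert this using 1
    ext ⟨x, y⟩
    simp [indicator, Function.uncurry]
  refine h1.aestronglyMeasurable.congr ?_
  filter_upwards [ae_restrict_mem measurableSet_Iic] with x hx
  rw [integral_indicator measurableSet_Ioc, intervalIntegral.integral_of_le hx]

lemma aestronglyMeasurable_rightWeylDeriv {h : ℝ → ℝ} (hh : Measurable h) (r b : ℝ) :
    AEStronglyMeasurable (rightWeylDeriv r b h) (volume.restrict (Iic b)) := by
  unfold rightWeylDeriv
  refine AEStronglyMeasurable.const_mul (AEStronglyMeasurable.add ?_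
    (AEStronglyMeasurable.const_mul ?_ _)) _
  · exact Measurable.aestronglyMeasurable (by fun_prop)
  · exact aestronglyMeasurable_integral_right
      (k := fun x y => (h x - h y) / (y - x) ^ (1 + r)) (by unfold Function.uncurry; fun_prop) b

lemma aestronglyMeasurable_leftWeylDeriv {h : ℝ → ℝ} (hh : Measurable h) (r a : ℝ) :
    AEStronglyMeasurable (leftWeylDeriv r a h) (volume.restrict (Ici a)) := by
  have h1 := aestronglyMeasurable_rightWeylDeriv (hh.comp measurable_neg) r (-a)
  have h2 : MeasurePreserving (fun x : ℝ => -x) (volume.restrict (Ici a))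
      (volume.restrict (Iic (-a))) := by
    have := (Measure.measurePreserving_neg (volume : Measure ℝ)).restrict_preimage
      (s := Iic (-a)) measurableSet_Iic
    simpa using this
  have h3 := h1.comp_measurePreserving h2
  refine h3.congr (ae_of_all _ fun x => ?_)
  simp only [Function.comp_apply, leftWeylDeriv_eq_rightWeylDeriv]
  rfl

/-! ### Generalized Stieltjes integrals of Hölder functions -/

/-- The constant in the bound for the Weyl derivative of order `r` of a `mu`-Hölder function. -/
noncomputable def weylConst (r mu : ℝ) : ℝ := (Real.Gamma (1 - r))⁻¹ * (1 + r / (mu - r))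

lemma weylConst_pos {r mu : ℝ} (hr : 0 < r) (hr1 : r < 1) (hmu : r < mu) : 0 < weylConst r mu := by
  have hG : 0 < Real.Gamma (1 - r) := Real.Gamma_pos_of_pos (by linarith)
  have : 0 < mu - r := by linarith
  unfold weylConst; positivity

lemma abs_rightWeylDeriv_le_of_eq_zero {r mu L : ℝ} (hr : 0 < r) (hr1 : r < 1) (hmu : r < mu)
    {h : ℝ → ℝ} (hh : ∀ x y, |h x - h y| ≤ L * |x - y| ^ mu) {x b : ℝ} (hxb : x < b)
    (hb : h b = 0) : |rightWeylDeriv r b h x| ≤ weylConst r mu * L * (b - x) ^ (mu - r) := by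
  refine (abs_rightWeylDeriv_le hr hr1 hmu hh hxb).trans (le_of_eq ?_)
  rw [hb, abs_zero, weylConst]; ring

lemma abs_leftWeylDeriv_le_of_eq_zero {r mu L : ℝ} (hr : 0 < r) (hr1 : r < 1) (hmu : r < mu)
    {h : ℝ → ℝ} (hh : ∀ x y, |h x - h y| ≤ L * |x - y| ^ mu) {x a : ℝ} (hax : a < x)
    (ha : h a = 0) : |leftWeylDeriv r a h x| ≤ weylConst r mu * L * (x - a) ^ (mu - r) := by
  refine (abs_leftWeylDeriv_le hr hr1 hmu hh hax).trans (le_of_eq ?_)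
  rw [ha, abs_zero, weylConst]; ring

lemma nonneg_of_holder {K lam : ℝ} {f : ℝ → ℝ} (hf : ∀ x y, |f x - f y| ≤ K * |x - y| ^ lam) :
    0 ≤ K := by
  have := (abs_nonneg _).trans (hf 1 0)
  simpa using this

lemma genStieltjesIntegral_eq {alpha : ℝ} {f g : ℝ → ℝ} (hg : Continuous g) (a b : ℝ) :
    genStieltjesIntegral alpha f g a b = -∫ x in a..b, leftWeylDeriv alpha a f x *
      rightWeylDeriv (1 - alpha) b (fun y => g y - g b) x := by
  rw [genStieltjesIntegral, hg.continuousWithinAt.leftLim_eq]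

section
variable {alpha lam beta K L : ℝ} {f g : ℝ → ℝ}

lemma holder_sub_const (hf : ∀ x y, |f x - f y| ≤ K * |x - y| ^ lam) (c : ℝ) (x y : ℝ) :
    |(f x - c) - (f y - c)| ≤ K * |x - y| ^ lam := by
  rw [sub_sub_sub_cancel_right]; exact hf x y

/-- The condition `f a = 0` removes the singular term `(x - a) ^ (-alpha)`, so the integrand is
bounded by a constant times `(b - a) ^ (lam + beta - 1)`. -/
lemma abs_genStieltjesIntegral_le (h0 : 0 < alpha) (h1 : alpha < 1) (hlam : alpha < lam)
    (hbeta : 1 - alpha < beta) (hf : ∀ x y, |f x - f y| ≤ K * |x - y| ^ lam)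
    (hg : ∀ x y, |g x - g y| ≤ L * |x - y| ^ beta) {a b : ℝ} (hab : a ≤ b) (hfa : f a = 0) :
    |genStieltjesIntegral alpha f g a b| ≤
      weylConst alpha lam * weylConst (1 - alpha) beta * K * L * (b - a) ^ (lam + beta) := by
  rcases hab.eq_or_lt with rfl | hab
  · simp [genStieltjesIntegral, Real.zero_rpow (show lam + beta ≠ 0 by linarith)]
  have hp : 0 < b - a := sub_pos.2 hab
  have hc1 := weylConst_pos h0 h1 hlam
  have hc2 := weylConst_pos (r := 1 - alpha) (by linarith) (by linarith) hbeta
  have hK := nonneg_of_holder hf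
  have hL := nonneg_of_holder hg
  rw [genStieltjesIntegral_eq (continuous_of_holder (by linarith) hg), abs_neg]
  have key : ∀ x ∈ Ioo a b, ‖leftWeylDeriv alpha a f x *
      rightWeylDeriv (1 - alpha) b (fun y => g y - g b) x‖ ≤
      weylConst alpha lam * weylConst (1 - alpha) beta * K * L * (b - a) ^ (lam + beta - 1) := by
    intro x hx
    have e1 := abs_leftWeylDeriv_le_of_eq_zero h0 h1 hlam hf hx.1 hfa
    have e2 := abs_rightWeylDeriv_le_of_eq_zero (r := 1 - alpha) (by linarith) (by linarith) hbeta
      (holder_sub_const hg (g b)) hx.2 (sub_self _)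
    have e3 : (x - a) ^ (lam - alpha) ≤ (b - a) ^ (lam - alpha) :=
      Real.rpow_le_rpow (by linarith [hx.1]) (by linarith [hx.2]) (by linarith)
    have e4 : (b - x) ^ (beta - (1 - alpha)) ≤ (b - a) ^ (beta - (1 - alpha)) :=
      Real.rpow_le_rpow (by linarith [hx.2]) (by linarith [hx.1]) (by linarith)
    rw [norm_mul, Real.norm_eq_abs, Real.norm_eq_abs]
    calc _ ≤ (weylConst alpha lam * K * (b - a) ^ (lam - alpha)) *
        (weylConst (1 - alpha) beta * L * (b - a) ^ (beta - (1 - alpha))) := by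
          refine mul_le_mul (e1.trans (by gcongr)) (e2.trans (by gcongr)) (abs_nonneg _) (by positivity)
      _ = _ := by
          rw [show lam + beta - 1 = (lam - alpha) + (beta - (1 - alpha)) by ring, Real.rpow_add hp]
          ring
  have := intervalIntegral.norm_integral_le_of_norm_le (μ := volume) hab.le
    (g := fun _ => weylConst alpha lam * weylConst (1 - alpha) beta * K * L *
      (b - a) ^ (lam + beta - 1)) (ae_mem_Ioc_imp_of_Ioo key) intervalIntegrable_const
  rw [intervalIntegral.integral_const, Real.norm_eq_abs, smul_eq_mul] at this
  refine this.trans (le_of_eq ?_)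
  rw [show lam + beta = (lam + beta - 1) + 1 by ring, Real.rpow_add_one hp.ne']
  ring_nf

lemma tendsto_genStieltjesIntegral (h0 : 0 < alpha) (h1 : alpha < 1) (hlam : alpha < lam)
    (hbeta : 1 - alpha < beta) {u v : ℕ → ℝ → ℝ}
    (hu : ∀ n x y, |u n x - u n y| ≤ K * |x - y| ^ lam)
    (hv : ∀ n x y, |v n x - v n y| ≤ L * |x - y| ^ beta)
    (hulim : ∀ x, Tendsto (fun n => u n x) atTop (𝓝 (f x)))
    (hvlim : ∀ x, Tendsto (fun n => v n x) atTop (𝓝 (g x)))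
    (hg : ∀ x y, |g x - g y| ≤ L * |x - y| ^ beta) {a b : ℝ} (hab : a ≤ b) :
    Tendsto (fun n => genStieltjesIntegral alpha (u n) (v n) a b) atTop
      (𝓝 (genStieltjesIntegral alpha f g a b)) := by
  have hr0 : 0 < 1 - alpha := by linarith
  have hr1 : 1 - alpha < 1 := by linarith
  have hK := nonneg_of_holder (hu 0)
  have hL := nonneg_of_holder hg
  simp only [genStieltjesIntegral_eq (continuous_of_holder (by linarith) hg),
    genStieltjesIntegral_eq (continuous_of_holder (by linarith) (hv _))]
  refine Tendsto.neg ?_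
  -- A convergent sequence is bounded; `A` weighs the singularity `(x - a) ^ (-alpha)` in the
  -- dominating function, integrable because `alpha < 1`.
  obtain ⟨A, hA⟩ : ∃ A, ∀ n, |u n a| ≤ A := by
    have := (hulim a).abs.bddAbove_range
    obtain ⟨A, hA⟩ := this
    exact ⟨A, fun n => hA ⟨n, rfl⟩⟩
  have hA0 : 0 ≤ A := (abs_nonneg _).trans (hA 0)
  have hc2 := weylConst_pos hr0 hr1 hbeta
  apply intervalIntegral.tendsto_integral_filter_of_dominated_convergence
    (fun x => (Real.Gamma (1 - alpha))⁻¹ * (A * (x - a) ^ (-alpha) +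
      (1 + alpha / (lam - alpha)) * K * (b - a) ^ (lam - alpha)) *
      (weylConst (1 - alpha) beta * L * (b - a) ^ (beta - (1 - alpha))))
  · refine Eventually.of_forall fun n => ?_
    rw [uIoc_of_le hab]
    refine AEStronglyMeasurable.mul ?_ ?_
    · exact (aestronglyMeasurable_leftWeylDeriv
        (continuous_of_holder (by linarith) (hu n)).measurable _ _).mono_set
        (fun x hx => hx.1.le)
    · exact (aestronglyMeasurable_rightWeylDeriv
        (continuous_of_holder (by linarith) (holder_sub_const (hv n) _)).measurable _ _).mono_set
        (fun x hx => hx.2)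
  · refine Eventually.of_forall fun n => ?_
    rw [uIoc_of_le hab]
    refine ae_mem_Ioc_imp_of_Ioo fun x hx => ?_
    have hG : 0 < Real.Gamma (1 - alpha) := Real.Gamma_pos_of_pos (by linarith)
    have hd : 0 < lam - alpha := by linarith
    have hxa : 0 < x - a := sub_pos.2 hx.1
    have hba : 0 < b - a := by linarith [hx.2]
    rw [norm_mul, Real.norm_eq_abs, Real.norm_eq_abs]
    refine mul_le_mul ((abs_leftWeylDeriv_le h0 h1 hlam (hu n) hx.1).trans ?_)
      ((abs_rightWeylDeriv_le_of_eq_zero hr0 hr1 hbeta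
      (holder_sub_const (hv n) _) hx.2 (sub_self _)).trans ?_) (abs_nonneg _) (by positivity)
    · have := hA n
      have h5 := hx.2.le
      gcongr
    · have := hx.1.le
      have h6 := hx.2.le
      gcongr
  · have := intervalIntegrable_sub_rpow_left (show -1 < -alpha by linarith) a a b
    exact (((this.const_mul A).add intervalIntegrable_const).const_mul _).mul_const _
  · rw [uIoc_of_le hab]
    refine ae_mem_Ioc_imp_of_Ioo fun x hx => ?_
    exact (tendsto_leftWeylDeriv hlam (by linarith) hu hulim hx.1).mul
      (tendsto_rightWeylDeriv hbeta (by linarith) (fun n => holder_sub_const (hv n) _)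
        (fun y => (hvlim y).sub (hvlim b)) hx.2)
end

/-! ### Fractional integration by parts for continuously differentiable functions -/

/-- Integration by parts, from the derivative of `(h y - h x) * (y - x) ^ (-r)`. The boundary term
at `x` vanishes since `h` is Hölder of order `mu > r`. -/
lemma rightWeylDeriv_eq_of_hasDerivAt {r mu L : ℝ} (hr : 0 < r) (hr1 : r < 1) (hmu : r < mu)
    {h h' : ℝ → ℝ} (hh : ∀ x y, |h x - h y| ≤ L * |x - y| ^ mu)
    (hd : ∀ x, HasDerivAt h (h' x) x) (hc : Continuous h') {x b : ℝ} (hxb : x < b) :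
    rightWeylDeriv r b h x = (Real.Gamma (1 - r))⁻¹ *
      (h b * (b - x) ^ (-r) - ∫ y in x..b, (y - x) ^ (-r) * h' y) := by
  have hp : 0 < b - x := sub_pos.2 hxb
  have hcont : Continuous h := continuous_of_holder (by linarith) hh
  have i1 : IntervalIntegrable (fun y => (y - x) ^ (-r) * h' y) volume x b :=
    (intervalIntegrable_sub_rpow_left (by linarith) x x b).mul_continuousOn hc.continuousOn
  have i2 : IntervalIntegrable (fun y => (h x - h y) / (y - x) ^ (1 + r)) volume x b := by
    refine IntervalIntegrable.mono_fun'
      ((intervalIntegrable_sub_rpow_left (show -1 < mu - (1 + r) by linarith) x x b).const_mul L)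
      (Measurable.aestronglyMeasurable (by have := hcont.measurable; fun_prop)) ?_
    rw [uIoc_of_le hxb.le]
    filter_upwards [ae_restrict_mem measurableSet_Ioc] with y hy
    exact abs_weyl_integrand_le hh hy.1
  have key := intervalIntegral.integral_eq_sub_of_hasDerivAt_of_tendsto hxb
    (f := fun y => (h y - h x) * (y - x) ^ (-r))
    (f' := fun y => (y - x) ^ (-r) * h' y + r * ((h x - h y) / (y - x) ^ (1 + r)))
    (fa := 0) (fb := (h b - h x) * (b - x) ^ (-r)) ?_ (i1.add (i2.const_mul r)) ?_ ?_
  · rw [intervalIntegral.integral_add i1 (i2.const_mul r), intervalIntegral.integral_const_mul] at key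
    unfold rightWeylDeriv
    congr 1
    rw [div_eq_mul_inv, ← Real.rpow_neg hp.le]
    linear_combination key
  · intro y hy
    have hy0 : 0 < y - x := sub_pos.2 hy.1
    have e1 : HasDerivAt (fun y => (y - x) ^ (-r)) (1 * (-r) * (y - x) ^ (-r - 1)) y :=
      HasDerivAt.rpow_const ((hasDerivAt_id y).sub_const x) (Or.inl hy0.ne')
    have e2 := ((hd y).sub_const (h x)).mul e1
    refine HasDerivAt.congr_deriv (f := fun y => (h y - h x) * (y - x) ^ (-r)) e2 ?_
    rw [show -r - 1 = -(1 + r) by ring, Real.rpow_neg hy0.le (1 + r)]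
    ring
  · have hlim : Tendsto (fun y => L * (y - x) ^ (mu - r)) (𝓝[>] x) (𝓝 0) := by
      have : ContinuousAt (fun y => L * (y - x) ^ (mu - r)) x :=
        continuousAt_const.mul (ContinuousAt.rpow_const (by fun_prop) (Or.inr (by linarith)))
      have h2 := this.tendsto
      rw [sub_self, Real.zero_rpow (by linarith), mul_zero] at h2
      exact h2.mono_left nhdsWithin_le_nhds
    refine squeeze_zero_norm' ?_ hlim
    filter_upwards [self_mem_nhdsWithin] with y hy
    have hy0 : 0 < y - x := sub_pos.2 hy
    rw [norm_mul, Real.norm_eq_abs, Real.norm_eq_abs, abs_of_pos (Real.rpow_pos_of_pos hy0 _),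
      sub_eq_add_neg mu, Real.rpow_add hy0, ← mul_assoc]
    have := hh y x
    rw [abs_of_pos hy0] at this
    gcongr
  · have : ContinuousAt (fun y => (h y - h x) * (y - x) ^ (-r)) b :=
      (hcont.continuousAt.sub continuousAt_const).mul
        (ContinuousAt.rpow_const (by fun_prop) (Or.inl hp.ne'))
    exact this.tendsto.mono_left nhdsWithin_le_nhds

lemma leftWeylDeriv_eq_of_hasDerivAt {r mu L : ℝ} (hr : 0 < r) (hr1 : r < 1) (hmu : r < mu)
    {h h' : ℝ → ℝ} (hh : ∀ x y, |h x - h y| ≤ L * |x - y| ^ mu)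
    (hd : ∀ x, HasDerivAt h (h' x) x) (hc : Continuous h') {x a : ℝ} (hax : a < x) :
    leftWeylDeriv r a h x = (Real.Gamma (1 - r))⁻¹ *
      (h a * (x - a) ^ (-r) + ∫ y in a..x, h' y * (x - y) ^ (-r)) := by
  rw [leftWeylDeriv_eq_rightWeylDeriv, rightWeylDeriv_eq_of_hasDerivAt hr hr1 hmu
    (holder_comp_neg hh) (h' := fun y => -h' (-y)) (fun y => ?_) (by fun_prop) (by linarith)]
  · have := intervalIntegral.integral_comp_neg (a := a) (b := x)
      (fun y => (y + x) ^ (-r) * h' (-y))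
    simp only [neg_neg] at this
    simp only [sub_neg_eq_add, mul_neg, intervalIntegral.integral_neg, neg_neg, neg_add_eq_sub]
    rw [← this]
    simp only [neg_add_eq_sub, mul_comm]
  · have := (hd (-y)).comp y (hasDerivAt_neg y)
    simpa [Function.comp_def] using this

/-- This is the Beta integral `B(1 - r, r)`; the exponents sum to `-1`, so the length of the
interval drops out. -/
lemma integral_sub_rpow_mul_sub_rpow {r : ℝ} (hr : 0 < r) (hr1 : r < 1) {c y : ℝ} (hcy : c < y) :
    ∫ x in c..y, (x - c) ^ (-r) * (y - x) ^ (r - 1) = Real.Gamma (1 - r) * Real.Gamma r := by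
  have hp : 0 < y - c := sub_pos.2 hcy
  have h1 := intervalIntegral.integral_comp_sub_right (a := c) (b := y)
    (fun x => x ^ (-r) * ((y - c) - x) ^ (r - 1)) c
  simp only [sub_sub_sub_cancel_right, sub_self] at h1
  rw [h1]
  have h2 := Complex.betaIntegral_scaled ((1 - r : ℝ) : ℂ) (r : ℂ) hp
  rw [Complex.betaIntegral_eq_Gamma_mul_div _ _ (by simpa using hr1) (by simpa using hr)] at h2
  have h3 : (((1 - r : ℝ) : ℂ) + (r : ℂ)) = 1 := by push_cast; ring
  rw [h3, sub_self, Complex.cpow_zero, one_mul, Complex.Gamma_one, div_one,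
    Complex.Gamma_ofReal, Complex.Gamma_ofReal] at h2
  apply Complex.ofReal_injective
  rw [← intervalIntegral.integral_ofReal, Complex.ofReal_mul, ← h2]
  refine intervalIntegral.integral_congr fun x hx => ?_
  rw [uIcc_of_le hp.le] at hx
  rw [Complex.ofReal_mul, Complex.ofReal_cpow hx.1, Complex.ofReal_cpow (by linarith [hx.2])]
  push_cast
  congr 2
  ring

section triangle
variable {p q : ℝ → ℝ} {a b r Q : ℝ}

/-- The truncated power encodes the triangle `z.2 < z.1`. Without `q` this is the integrand of a
convolution of two integrable functions, and `q` is a bounded factor. -/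
lemma integrable_triangle_kernel (hab : a ≤ b) (hr : -1 < r) (hp : IntervalIntegrable p volume a b)
    (hq : AEStronglyMeasurable q (volume.restrict (Ioc a b)))
    (hQ : ∀ x ∈ Ioc a b, |q x| ≤ Q) :
    Integrable (fun z : ℝ × ℝ => (Ioc a b).indicator q z.1 * ((Ioc a b).indicator p z.2 *
      (Ioo 0 (b - a)).indicator (fun t => t ^ r) (z.1 - z.2))) (volume.prod volume) := by
  have h1 : Integrable ((Ioc a b).indicator p) := by
    rw [intervalIntegrable_iff_integrableOn_Ioc_of_le hab] at hp
    exact (integrable_indicator_iff measurableSet_Ioc).2 hp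
  have h2 : Integrable ((Ioo 0 (b - a)).indicator (fun t : ℝ => t ^ r)) := by
    have := intervalIntegral.intervalIntegrable_rpow' (a := 0) (b := b - a) hr
    rw [intervalIntegrable_iff_integrableOn_Ioo_of_le (by linarith)] at this
    exact (integrable_indicator_iff measurableSet_Ioo).2 this
  have h3 := h1.convolution_integrand (ContinuousLinearMap.mul ℝ ℝ) h2
  refine h3.bdd_mul (c := max Q 0) ?_ ?_
  · exact ((aestronglyMeasurable_indicator_iff measurableSet_Ioc).2 hq).comp_fst
  · refine ae_of_all _ fun z => ?_
    by_cases hz : z.1 ∈ Ioc a b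
    · rw [indicator_of_mem hz]; exact (hQ _ hz).trans (le_max_left _ _)
    · rw [indicator_of_notMem hz]; simp

lemma integral_triangle_kernel_snd {y : ℝ} :
    ∫ x, (Ioc a b).indicator q y * ((Ioc a b).indicator p x *
      (Ioo 0 (b - a)).indicator (fun t => t ^ r) (y - x)) =
      (Ioc a b).indicator (fun y => q y * ∫ x in a..y, p x * (y - x) ^ r) y := by
  rw [integral_const_mul]
  by_cases hy : y ∈ Ioc a b
  · rw [indicator_of_mem hy, indicator_of_mem hy, intervalIntegral.integral_of_le hy.1.le,
      integral_Ioc_eq_integral_Ioo, ← integral_indicator measurableSet_Ioo]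
    congr 2
    ext x
    by_cases hx : x ∈ Ioo a y
    · rw [indicator_of_mem hx, indicator_of_mem (s := Ioc a b) ⟨hx.1, hx.2.le.trans hy.2⟩,
        indicator_of_mem (s := Ioo 0 (b - a)) ⟨by linarith [hx.2], by linarith [hx.1, hy.2]⟩]
    · rw [indicator_of_notMem hx]
      by_cases hx2 : x ∈ Ioc a b
      · rw [indicator_of_notMem (s := Ioo 0 (b - a)), mul_zero]
        exact fun h => hx ⟨hx2.1, by linarith [h.1]⟩
      · rw [indicator_of_notMem hx2, zero_mul]
  · rw [indicator_of_notMem hy, indicator_of_notMem hy, zero_mul]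

lemma integral_triangle_kernel_fst {x : ℝ} :
    ∫ y, (Ioc a b).indicator q y * ((Ioc a b).indicator p x *
      (Ioo 0 (b - a)).indicator (fun t => t ^ r) (y - x)) =
      (Ioc a b).indicator (fun x => p x * ∫ y in x..b, (y - x) ^ r * q y) x := by
  by_cases hx : x ∈ Ioc a b
  · rw [indicator_of_mem hx, indicator_of_mem hx, intervalIntegral.integral_of_le hx.2,
      ← integral_const_mul, ← integral_indicator measurableSet_Ioc]
    congr 1
    ext y
    by_cases hy : y ∈ Ioc x b
    · rw [indicator_of_mem hy, indicator_of_mem (s := Ioc a b) ⟨hx.1.trans hy.1, hy.2⟩,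
        indicator_of_mem (s := Ioo 0 (b - a)) ⟨by linarith [hy.1], by linarith [hx.1, hy.2]⟩]
      ring
    · rw [indicator_of_notMem hy]
      by_cases hy2 : y ∈ Ioc a b
      · rw [indicator_of_notMem (s := Ioo 0 (b - a)), mul_zero, mul_zero]
        exact fun h => hy ⟨by linarith [h.1], hy2.2⟩
      · rw [indicator_of_notMem hy2, zero_mul]
  · simp [indicator_of_notMem hx]

lemma intervalIntegrable_triangle (hab : a ≤ b) (hr : -1 < r) (hp : IntervalIntegrable p volume a b)
    (hq : AEStronglyMeasurable q (volume.restrict (Ioc a b)))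
    (hQ : ∀ x ∈ Ioc a b, |q x| ≤ Q) :
    IntervalIntegrable (fun y => q y * ∫ x in a..y, p x * (y - x) ^ r) volume a b := by
  have := (integrable_triangle_kernel hab hr hp hq hQ).integral_prod_left
  simp only [integral_triangle_kernel_snd] at this
  rw [intervalIntegrable_iff_integrableOn_Ioc_of_le hab]
  exact (integrable_indicator_iff measurableSet_Ioc).1 this

lemma integral_triangle_swap (hab : a ≤ b) (hr : -1 < r) (hp : IntervalIntegrable p volume a b)
    (hq : AEStronglyMeasurable q (volume.restrict (Ioc a b)))
    (hQ : ∀ x ∈ Ioc a b, |q x| ≤ Q) :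
    ∫ y in a..b, q y * ∫ x in a..y, p x * (y - x) ^ r =
      ∫ x in a..b, p x * ∫ y in x..b, (y - x) ^ r * q y := by
  have := integral_integral_swap (f := fun y x => (Ioc a b).indicator q y *
    ((Ioc a b).indicator p x * (Ioo 0 (b - a)).indicator (fun t => t ^ r) (y - x)))
    (integrable_triangle_kernel hab hr hp hq hQ)
  simp only [integral_triangle_kernel_snd, integral_triangle_kernel_fst] at this
  rwa [integral_indicator measurableSet_Ioc, integral_indicator measurableSet_Ioc,
    ← intervalIntegral.integral_of_le hab, ← intervalIntegral.integral_of_le hab] at this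
end triangle

section smooth
variable {alpha lam beta K L : ℝ} {f g f' g' : ℝ → ℝ}

/-- Semigroup property of fractional integrals: orders `1 - alpha` and `alpha` compose to ordinary
integration. After exchanging the integrals, the inner one is a Beta integral. -/
lemma integral_sub_rpow_mul_fractionalIntegral (h0 : 0 < alpha) (h1 : alpha < 1)
    (hgd : ∀ x, HasDerivAt g (g' x) x) (hgc : Continuous g') {c b : ℝ} (hcb : c ≤ b) :
    ∫ x in c..b, (x - c) ^ (-alpha) * ∫ y in x..b, (y - x) ^ (alpha - 1) * g' y =
      Real.Gamma (1 - alpha) * Real.Gamma alpha * (g b - g c) := by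
  obtain ⟨Q, hQ⟩ := isCompact_Icc.exists_bound_of_continuousOn (s := Icc c b) hgc.continuousOn
  rw [← integral_triangle_swap (p := fun x => (x - c) ^ (-alpha)) (q := g') (Q := Q) hcb
    (by linarith) (intervalIntegrable_sub_rpow_left (by linarith) c c b)
    hgc.aestronglyMeasurable (fun x hx => hQ x ⟨hx.1.le, hx.2⟩)]
  rw [intervalIntegral.integral_congr_ae
    (g := fun y => (Real.Gamma (1 - alpha) * Real.Gamma alpha) * g' y)]
  · rw [intervalIntegral.integral_const_mul, intervalIntegral.integral_eq_sub_of_hasDerivAt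
      (fun x _ => hgd x) (hgc.intervalIntegrable _ _)]
  · rw [uIoc_of_le hcb]
    refine ae_of_all _ fun y hy => ?_
    rw [integral_sub_rpow_mul_sub_rpow h0 h1 hy.1, mul_comm]

/-- For `C¹` functions both Weyl derivatives are fractional integrals of `f'` and `g'`, up to the
boundary term of `f`, so Fubini applies. The right side is the classical integral of `f * g'`,
integrated by parts. -/
lemma genStieltjesIntegral_of_hasDerivAt (h0 : 0 < alpha) (h1 : alpha < 1) (hlam : alpha < lam)
    (hbeta : 1 - alpha < beta) (hf : ∀ x y, |f x - f y| ≤ K * |x - y| ^ lam)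
    (hg : ∀ x y, |g x - g y| ≤ L * |x - y| ^ beta)
    (hfd : ∀ x, HasDerivAt f (f' x) x) (hfc : Continuous f')
    (hgd : ∀ x, HasDerivAt g (g' x) x) (hgc : Continuous g') {a b : ℝ} (hab : a ≤ b) :
    genStieltjesIntegral alpha f g a b =
      f a * (g b - g a) + ∫ y in a..b, f' y * (g b - g y) := by
  have hG : Real.Gamma alpha ≠ 0 := (Real.Gamma_pos_of_pos h0).ne'
  have hG1 : Real.Gamma (1 - alpha) ≠ 0 := (Real.Gamma_pos_of_pos (by linarith)).ne'
  -- Up to the factor `-1 / Γ(alpha)`, this is the Weyl derivative of order `1 - alpha` of `g - g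
  -- b`; its boundedness lets it play the role of `q` in the triangle lemmas.
  set S : ℝ → ℝ := fun x => ∫ y in x..b, (y - x) ^ (alpha - 1) * g' y with hS
  obtain ⟨Q, hQ⟩ := isCompact_Icc.exists_bound_of_continuousOn (s := Icc a b) hgc.continuousOn
  have hSm : AEStronglyMeasurable S (volume.restrict (Ioc a b)) :=
    (aestronglyMeasurable_integral_right (k := fun x y => (y - x) ^ (alpha - 1) * g' y)
      (by have := hgc.measurable; unfold Function.uncurry; fun_prop) b).mono_set fun x hx => hx.2
  have hSb : ∀ x ∈ Ioc a b, |S x| ≤ Q * ((b - a) ^ alpha / alpha) := by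
    intro x hx
    have hQ0 : 0 ≤ Q := (norm_nonneg _).trans (hQ b ⟨hab, le_rfl⟩)
    have := intervalIntegral.norm_integral_le_of_norm_le (μ := volume) hx.2
      (f := fun y => (y - x) ^ (alpha - 1) * g' y) (g := fun y => Q * (y - x) ^ (alpha - 1))
      (ae_of_all _ fun y hy => by
        have hyp : 0 < y - x := sub_pos.2 hy.1
        rw [norm_mul, mul_comm, Real.norm_eq_abs (_ ^ _), abs_of_pos (Real.rpow_pos_of_pos hyp _)]
        have := hQ y ⟨hx.1.le.trans hy.1.le, hy.2⟩
        gcongr)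
      ((intervalIntegrable_sub_rpow_left (by linarith) x x b).const_mul Q)
    rw [intervalIntegral.integral_const_mul, integral_sub_rpow_left (by linarith),
      sub_add_cancel] at this
    refine this.trans ?_
    have e1 : (b - x) ^ alpha ≤ (b - a) ^ alpha :=
      Real.rpow_le_rpow (by linarith [hx.2]) (by linarith [hx.1]) h0.le
    gcongr
  have hSi : IntervalIntegrable (fun x => (x - a) ^ (-alpha) * S x) volume a b := by
    have i0 := intervalIntegrable_sub_rpow_left (show -1 < -alpha by linarith) a a b
    rw [intervalIntegrable_iff_integrableOn_Ioc_of_le hab] at i0 ⊢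
    exact i0.mul_bdd hSm ((ae_restrict_iff' measurableSet_Ioc).2 (ae_of_all _ hSb))
  have hTi := intervalIntegrable_triangle hab (show -1 < -alpha by linarith)
    (hfc.intervalIntegrable a b) hSm hSb
  have hsw := integral_triangle_swap hab (show -1 < -alpha by linarith)
    (hfc.intervalIntegrable a b) hSm hSb
  have hint := integral_sub_rpow_mul_fractionalIntegral h0 h1 hgd hgc hab
  rw [genStieltjesIntegral_eq (continuous_of_holder (by linarith) hg),
    intervalIntegral.integral_congr_ae (g := fun x =>
      -((Real.Gamma (1 - alpha))⁻¹ * (Real.Gamma alpha)⁻¹ * (f a * ((x - a) ^ (-alpha) * S x) +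
        S x * ∫ y in a..x, f' y * (x - y) ^ (-alpha))))]
  · rw [intervalIntegral.integral_neg, neg_neg, intervalIntegral.integral_const_mul,
      intervalIntegral.integral_add (hSi.const_mul _) hTi, intervalIntegral.integral_const_mul,
      hsw, hint]
    rw [intervalIntegral.integral_congr (g := fun x =>
      (Real.Gamma (1 - alpha) * Real.Gamma alpha) * (f' x * (g b - g x)))]
    · rw [intervalIntegral.integral_const_mul]
      field_simp
    · intro x hx
      rw [uIcc_of_le hab] at hx
      simp only
      rw [integral_sub_rpow_mul_fractionalIntegral h0 h1 hgd hgc hx.2]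
      ring
  · rw [uIoc_of_le hab]
    refine ae_mem_Ioc_imp_of_Ioo fun x hx => ?_
    rw [leftWeylDeriv_eq_of_hasDerivAt h0 h1 hlam hf hfd hfc hx.1,
      rightWeylDeriv_eq_of_hasDerivAt (r := 1 - alpha) (h' := g') (by linarith) (by linarith) hbeta
        (holder_sub_const hg _) (fun y => (hgd y).sub_const _) hgc hx.2]
    simp only [sub_self, zero_mul, zero_sub, neg_sub, sub_sub_cancel, hS]
    ring

end smooth

/-! ### Smooth approximation by moving averages -/

section averages

/-- The average of `f` over `[x, x + h]`. -/
noncomputable def steklovAverage (h : ℝ) (f : ℝ → ℝ) (x : ℝ) : ℝ :=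
  h⁻¹ * ((∫ y in (0 : ℝ)..(x + h), f y) - ∫ y in (0 : ℝ)..x, f y)

variable {K lam h : ℝ} {f : ℝ → ℝ}

lemma hasDerivAt_steklovAverage (hf : Continuous f) (h x : ℝ) :
    HasDerivAt (steklovAverage h f) (h⁻¹ * (f (x + h) - f x)) x := by
  have h1 : ∀ x, HasDerivAt (fun u => ∫ y in (0 : ℝ)..u, f y) (f x) x := fun x =>
    intervalIntegral.integral_hasDerivAt_right (hf.intervalIntegrable _ _)
      (hf.stronglyMeasurableAtFilter _ _) hf.continuousAt
  exact (((h1 (x + h)).comp_add_const x h).sub (h1 x)).const_mul _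

lemma steklovAverage_eq (hf : Continuous f) (hh : h ≠ 0) (x : ℝ) :
    steklovAverage h f x = ∫ u in (0 : ℝ)..1, f (x + h * u) := by
  rw [steklovAverage, intervalIntegral.integral_interval_sub_left (hf.intervalIntegrable _ _)
    (hf.intervalIntegrable _ _), intervalIntegral.integral_comp_add_mul _ hh]
  simp

/-- An average of translates does not increase the Hölder constant. This uniformity is what the
dominated convergence in `tendsto_genStieltjesIntegral` requires. -/
lemma steklovAverage_holder (hlam : 0 < lam) (hf : ∀ x y, |f x - f y| ≤ K * |x - y| ^ lam)
    (hh : h ≠ 0) (x y : ℝ) :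
    |steklovAverage h f x - steklovAverage h f y| ≤ K * |x - y| ^ lam := by
  have hc := continuous_of_holder hlam hf
  rw [steklovAverage_eq hc hh, steklovAverage_eq hc hh, ← intervalIntegral.integral_sub
    (Continuous.intervalIntegrable (by fun_prop) _ _)
    (Continuous.intervalIntegrable (by fun_prop) _ _)]
  have := intervalIntegral.norm_integral_le_of_norm_le_const (a := 0) (b := 1)
    (f := fun u => f (x + h * u) - f (y + h * u)) (C := K * |x - y| ^ lam)
    (fun u _ => by simpa using hf (x + h * u) (y + h * u))
  simpa using this

lemma tendsto_steklovAverage (hlam : 0 < lam) (hf : ∀ x y, |f x - f y| ≤ K * |x - y| ^ lam)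
    (x : ℝ) : Tendsto (fun n : ℕ => steklovAverage (1 / ((n : ℝ) + 1)) f x) atTop (𝓝 (f x)) := by
  have hc := continuous_of_holder hlam hf
  have hK := nonneg_of_holder hf
  rw [tendsto_iff_dist_tendsto_zero]
  have h1 : Tendsto (fun n : ℕ => K * (1 / ((n : ℝ) + 1)) ^ lam) atTop (𝓝 0) := by
    have := (tendsto_one_div_add_atTop_nhds_zero_nat (𝕜 := ℝ)).rpow_const (p := lam)
      (Or.inr hlam.le)
    rw [Real.zero_rpow hlam.ne'] at this
    simpa using this.const_mul K
  refine squeeze_zero (fun _ => dist_nonneg) (fun n => ?_) h1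
  have hn : (0 : ℝ) < 1 / ((n : ℝ) + 1) := by positivity
  set h := 1 / ((n : ℝ) + 1)
  have e1 : f x = ∫ _ in (0 : ℝ)..1, f x := by simp
  rw [Real.dist_eq, steklovAverage_eq hc hn.ne', e1]
  rw [← intervalIntegral.integral_sub (Continuous.intervalIntegrable (by fun_prop) _ _)
    intervalIntegrable_const]
  have := intervalIntegral.norm_integral_le_of_norm_le_const (a := 0) (b := 1)
    (f := fun u => f (x + h * u) - f x) (C := K * h ^ lam)
    (fun u hu => by
      rw [uIoc_of_le zero_le_one] at hu
      refine (hf _ _).trans ?_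
      have h2 : |x + h * u - x| ≤ h := by
        rw [add_sub_cancel_left, abs_of_nonneg (mul_nonneg hn.le hu.1.le)]
        exact mul_le_of_le_one_right hn.le hu.2
      gcongr)
  simpa using this
end averages

/-! ### Additivity, the Young-Loève estimate, linearity and locality -/

section additivity
variable {alpha lam beta K L : ℝ} {f g : ℝ → ℝ}

lemma exists_smooth_approx (hlam : 0 < lam) (hf : ∀ x y, |f x - f y| ≤ K * |x - y| ^ lam) :
    ∃ u u' : ℕ → ℝ → ℝ, (∀ n x y, |u n x - u n y| ≤ K * |x - y| ^ lam) ∧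
      (∀ n x, HasDerivAt (u n) (u' n x) x) ∧ (∀ n, Continuous (u' n)) ∧
      ∀ x, Tendsto (fun n => u n x) atTop (𝓝 (f x)) := by
  have hc := continuous_of_holder hlam hf
  exact ⟨fun n => steklovAverage (1 / ((n : ℝ) + 1)) f, _,
    fun n => steklovAverage_holder hlam hf (by positivity),
    fun n => hasDerivAt_steklovAverage hc _, fun n => by fun_prop, tendsto_steklovAverage hlam hf⟩

/-- Additivity of the generalized Stieltjes integral over adjacent intervals. -/
lemma genStieltjesIntegral_add_adjacent (h0 : 0 < alpha) (h1 : alpha < 1) (hlam : alpha < lam)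
    (hbeta : 1 - alpha < beta) (hf : ∀ x y, |f x - f y| ≤ K * |x - y| ^ lam)
    (hg : ∀ x y, |g x - g y| ≤ L * |x - y| ^ beta) {a b c : ℝ} (hab : a ≤ b) (hbc : b ≤ c) :
    genStieltjesIntegral alpha f g a b + genStieltjesIntegral alpha f g b c =
      genStieltjesIntegral alpha f g a c := by
  obtain ⟨u, u', hu, hud, huc, hul⟩ := exists_smooth_approx (by linarith) hf
  obtain ⟨v, v', hv, hvd, hvc, hvl⟩ := exists_smooth_approx (by linarith) hg
  have key : ∀ {a b : ℝ}, a ≤ b → Tendsto (fun n => genStieltjesIntegral alpha (u n) (v n) a b)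
      atTop (𝓝 (genStieltjesIntegral alpha f g a b)) := fun hab =>
    tendsto_genStieltjesIntegral h0 h1 hlam hbeta hu hv hul hvl hg hab
  refine tendsto_nhds_unique ((key hab).add (key hbc)) ((key (hab.trans hbc)).congr fun n => ?_)
  have hvcont : Continuous (v n) := continuous_of_holder (by linarith) (hv n)
  have hU := huc n
  have i : ∀ a b z, IntervalIntegrable (fun y => u' n y * (z - v n y)) volume a b :=
    fun a b z => Continuous.intervalIntegrable (by fun_prop) _ _
  simp only [genStieltjesIntegral_of_hasDerivAt h0 h1 hlam hbeta (hu n) (hv n) (hud n) (huc n)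
    (hvd n) (hvc n), hab, hbc, hab.trans hbc]
  rw [← intervalIntegral.integral_add_adjacent_intervals (i a b (v n c)) (i b c (v n c))]
  have e1 : ∫ y in a..b, u' n y * (v n c - v n y) =
      (v n c - v n b) * (u n b - u n a) + ∫ y in a..b, u' n y * (v n b - v n y) := by
    rw [← intervalIntegral.integral_eq_sub_of_hasDerivAt (fun x _ => hud n x)
      ((huc n).intervalIntegrable a b), ← intervalIntegral.integral_const_mul,
      ← intervalIntegral.integral_add (Continuous.intervalIntegrable (by fun_prop) _ _) (i _ _ _)]
    congr 1; ext y; ring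
  rw [e1]; ring

/-- The Young-Loève estimate for the generalized Stieltjes integral. -/
lemma abs_genStieltjesIntegral_sub_le (h0 : 0 < alpha) (h1 : alpha < 1) (hlam : alpha < lam)
    (hbeta : 1 - alpha < beta) (hf : ∀ x y, |f x - f y| ≤ K * |x - y| ^ lam)
    (hg : ∀ x y, |g x - g y| ≤ L * |x - y| ^ beta) {a b : ℝ} (hab : a ≤ b) :
    |genStieltjesIntegral alpha f g a b - f a * (g b - g a)| ≤
      weylConst alpha lam * weylConst (1 - alpha) beta * K * L * (b - a) ^ (lam + beta) := by
  obtain ⟨u, u', hu, hud, huc, hul⟩ := exists_smooth_approx (by linarith) hf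
  obtain ⟨v, v', hv, hvd, hvc, hvl⟩ := exists_smooth_approx (by linarith) hg
  have key : Tendsto (fun n => |genStieltjesIntegral alpha (u n) (v n) a b -
      u n a * (v n b - v n a)|) atTop
      (𝓝 |genStieltjesIntegral alpha f g a b - f a * (g b - g a)|) :=
    ((tendsto_genStieltjesIntegral h0 h1 hlam hbeta hu hv hul hvl hg hab).sub
      ((hul a).mul ((hvl b).sub (hvl a)))).abs
  refine le_of_tendsto' key fun n => ?_
  -- The integrand `u n - u n a` vanishes at `a`. For smooth functions, subtracting this constant
  -- removes exactly `u n a * (v n b - v n a)` from the integral.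
  have := abs_genStieltjesIntegral_le h0 h1 hlam hbeta (holder_sub_const (hu n) (u n a)) (hv n) hab
    (sub_self _)
  rw [genStieltjesIntegral_of_hasDerivAt h0 h1 hlam hbeta (holder_sub_const (hu n) (u n a)) (hv n)
    (fun x => (hud n x).sub_const _) (huc n) (hvd n) (hvc n) hab] at this
  rw [genStieltjesIntegral_of_hasDerivAt h0 h1 hlam hbeta (hu n) (hv n) (hud n) (huc n) (hvd n)
    (hvc n) hab, add_sub_cancel_left]
  simpa using this
end additivity

section
variable {alpha lam beta K L : ℝ} {f g : ℝ → ℝ}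

lemma genStieltjesIntegral_sub_left (h0 : 0 < alpha) (h1 : alpha < 1) (hlam : alpha < lam)
    (hbeta : 1 - alpha < beta) {f₁ f₂ : ℝ → ℝ} {K₁ K₂ : ℝ}
    (hf₁ : ∀ x y, |f₁ x - f₁ y| ≤ K₁ * |x - y| ^ lam)
    (hf₂ : ∀ x y, |f₂ x - f₂ y| ≤ K₂ * |x - y| ^ lam)
    (hg : ∀ x y, |g x - g y| ≤ L * |x - y| ^ beta) {a b : ℝ} (hab : a ≤ b) :
    genStieltjesIntegral alpha f₁ g a b - genStieltjesIntegral alpha f₂ g a b =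
      genStieltjesIntegral alpha (fun x => f₁ x - f₂ x) g a b := by
  obtain ⟨u, u', hu, hud, huc, hul⟩ := exists_smooth_approx (by linarith) hf₁
  obtain ⟨w, w', hw, hwd, hwc, hwl⟩ := exists_smooth_approx (by linarith) hf₂
  obtain ⟨v, v', hv, hvd, hvc, hvl⟩ := exists_smooth_approx (by linarith) hg
  have huw : ∀ n x y, |(u n x - w n x) - (u n y - w n y)| ≤ (K₁ + K₂) * |x - y| ^ lam := by
    intro n x y
    rw [show (u n x - w n x) - (u n y - w n y) = (u n x - u n y) - (w n x - w n y) by ring, add_mul]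
    exact (abs_sub _ _).trans (add_le_add (hu n x y) (hw n x y))
  refine tendsto_nhds_unique
    ((tendsto_genStieltjesIntegral h0 h1 hlam hbeta hu hv hul hvl hg hab).sub
      (tendsto_genStieltjesIntegral h0 h1 hlam hbeta hw hv hwl hvl hg hab))
    ((tendsto_genStieltjesIntegral h0 h1 hlam hbeta huw hv (fun x => (hul x).sub (hwl x)) hvl hg
      hab).congr fun n => ?_)
  have hvcont : Continuous (v n) := continuous_of_holder (by linarith) (hv n)
  have e1 := huc n
  have e2 := hwc n
  rw [genStieltjesIntegral_of_hasDerivAt h0 h1 hlam hbeta (hu n) (hv n) (hud n) (huc n)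
    (hvd n) (hvc n) hab, genStieltjesIntegral_of_hasDerivAt h0 h1 hlam hbeta (hw n) (hv n) (hwd n)
    (hwc n) (hvd n) (hvc n) hab, genStieltjesIntegral_of_hasDerivAt h0 h1 hlam hbeta (huw n) (hv n)
    (fun x => (hud n x).sub (hwd n x)) ((huc n).sub (hwc n)) (hvd n) (hvc n) hab]
  simp only [sub_mul]
  rw [intervalIntegral.integral_sub (Continuous.intervalIntegrable (by fun_prop) _ _)
    (Continuous.intervalIntegrable (by fun_prop) _ _)]
  ring

/-- The Weyl derivatives and the left limit at `b` see only values on `[a, b]`. Paths controlled on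
`[0, T]` alone may therefore be replaced by their constant extensions to the line. -/
lemma genStieltjesIntegral_congr {f' g' : ℝ → ℝ} {a b : ℝ} (hab : a ≤ b)
    (hf : ∀ x ∈ Icc a b, f x = f' x) (hg : ∀ x ∈ Icc a b, g x = g' x) (hg' : Continuous g') :
    genStieltjesIntegral alpha f g a b = genStieltjesIntegral alpha f' g' a b := by
  rcases hab.eq_or_lt with rfl | hab
  · simp [genStieltjesIntegral]
  have hl : Function.leftLim g b = g' b := by
    apply leftLim_eq_of_tendsto
    have h1 : Tendsto g' (𝓝[<] b) (𝓝 (g' b)) := hg'.continuousAt.tendsto.mono_left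
      nhdsWithin_le_nhds
    refine h1.congr' ?_
    filter_upwards [Ioo_mem_nhdsLT hab] with x hx
    exact (hg x ⟨hx.1.le, hx.2.le⟩).symm
  rw [genStieltjesIntegral_eq hg', genStieltjesIntegral, hl]
  congr 1
  refine intervalIntegral.integral_congr fun x hx => ?_
  rw [uIcc_of_le hab.le] at hx
  have e1 : leftWeylDeriv alpha a f x = leftWeylDeriv alpha a f' x := by
    unfold leftWeylDeriv
    rw [hf x hx, intervalIntegral.integral_congr fun y hy => ?_]
    rw [uIcc_of_le hx.1] at hy
    simp only [hf y ⟨hy.1, hy.2.trans hx.2⟩]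
  have e2 : rightWeylDeriv (1 - alpha) b (fun y => g y - g' b) x =
      rightWeylDeriv (1 - alpha) b (fun y => g' y - g' b) x := by
    unfold rightWeylDeriv
    simp only
    rw [hg x hx, intervalIntegral.integral_congr fun y hy => ?_]
    rw [uIcc_of_le hx.2] at hy
    simp only [hg y ⟨hx.1.trans hy.1, hy.2⟩]
  simp only [e1, e2]
end

/-- `f` is `lam`-Hölder on `[a, b]` with constant `K`. -/
def HolderBound {E : Type*} [NormedAddCommGroup E] (K lam a b : ℝ) (f : ℝ → E) : Prop :=
  ∀ u ∈ Icc a b, ∀ v ∈ Icc a b, ‖f u - f v‖ ≤ K * |u - v| ^ lam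

section
variable {E : Type*} [NormedAddCommGroup E] {K lam a b : ℝ} {f : ℝ → E}

lemma HolderBound.mono {a' b' : ℝ} (hf : HolderBound K lam a b f) (ha : a ≤ a') (hb : b' ≤ b) :
    HolderBound K lam a' b' f :=
  fun u hu v hv => hf u ⟨ha.trans hu.1, hu.2.trans hb⟩ v ⟨ha.trans hv.1, hv.2.trans hb⟩

lemma HolderBound.of_le (hf : ∀ s t, a ≤ s → s ≤ t → t ≤ b → ‖f t - f s‖ ≤ K * (t - s) ^ lam) :
    HolderBound K lam a b f := by
  intro u hu v hv
  rcases le_total u v with h | h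
  · rw [norm_sub_rev, abs_sub_comm, abs_of_nonneg (sub_nonneg.2 h)]
    exact hf u v hu.1 h hv.2
  · rw [abs_of_nonneg (sub_nonneg.2 h)]
    exact hf v u hv.1 h hu.2

lemma HolderBound.le (hf : HolderBound K lam a b f) {s t : ℝ} (hs : a ≤ s) (hst : s ≤ t)
    (ht : t ≤ b) : ‖f t - f s‖ ≤ K * (t - s) ^ lam := by
  have := hf t ⟨hs.trans hst, ht⟩ s ⟨hs, hst.trans ht⟩
  rwa [abs_of_nonneg (sub_nonneg.2 hst)] at this

lemma HolderBound.projIcc (hlam : 0 ≤ lam) (hK : 0 ≤ K) (hf : HolderBound K lam a b f)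
    (hab : a ≤ b) (x y : ℝ) :
    ‖f (Set.projIcc a b hab x) - f (Set.projIcc a b hab y)‖ ≤ K * |x - y| ^ lam := by
  refine (hf _ (Set.projIcc a b hab x).2 _ (Set.projIcc a b hab y).2).trans ?_
  have := abs_projIcc_sub_projIcc (c := x) (d := y) hab
  gcongr

lemma HolderBound.exists_nonneg (hf : HolderBound K lam a b f) :
    ∃ K', 0 ≤ K' ∧ HolderBound K' lam a b f :=
  ⟨max K 0, le_max_right _ _, fun u hu v hv => (hf u hu v hv).trans (by
    gcongr; exact le_max_left _ _)⟩
end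

/-- The constant in the Young-Loève estimate. -/
noncomputable def youngConst (alpha lam beta : ℝ) : ℝ :=
  weylConst alpha lam * weylConst (1 - alpha) beta

/-- Increments of the difference of two generalized Stieltjes integrals with the same integrator. -/
lemma abs_genStieltjesIntegral_increment_le {alpha lam beta K K₁ K₂ L T : ℝ} {f₁ f₂ g : ℝ → ℝ}
    (h0 : 0 < alpha) (h1 : alpha < 1) (hlam : alpha < lam) (hbeta : 1 - alpha < beta)
    (hf₁ : HolderBound K₁ lam 0 T f₁) (hf₂ : HolderBound K₂ lam 0 T f₂) (hL : 0 ≤ L)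
    (hg : HolderBound L beta 0 T g) {s t : ℝ} (hs : 0 ≤ s) (hst : s ≤ t) (ht : t ≤ T)
    (hK : 0 ≤ K) (hf : HolderBound K lam s t (fun x => f₁ x - f₂ x)) :
    |(genStieltjesIntegral alpha f₁ g 0 t - genStieltjesIntegral alpha f₂ g 0 t) -
      (genStieltjesIntegral alpha f₁ g 0 s - genStieltjesIntegral alpha f₂ g 0 s)| ≤
      |f₁ s - f₂ s| * (L * (t - s) ^ beta) +
        youngConst alpha lam beta * K * L * (t - s) ^ (lam + beta) := by
  have hT : 0 ≤ T := hs.trans (hst.trans ht)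
  obtain ⟨K₁, hK₁, hf₁⟩ := hf₁.exists_nonneg
  obtain ⟨K₂, hK₂, hf₂⟩ := hf₂.exists_nonneg
  -- Clamping time to `[0, T]` turns the local Hölder bounds into global ones.
  set p : ℝ → ℝ := fun x => Set.projIcc 0 T hT x with hp
  have hpe : ∀ x ∈ Icc 0 T, p x = x := fun x hx => by simp [hp, projIcc_of_mem hT hx]
  have c₁ := hf₁.projIcc (by linarith) hK₁ hT
  have c₂ := hf₂.projIcc (by linarith) hK₂ hT
  have cg := hg.projIcc (by linarith) hL hT
  have hgc : Continuous (fun x => g (p x)) := continuous_of_holder (by linarith) cg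
  have cong : ∀ (F : ℝ → ℝ) (r : ℝ), 0 ≤ r → r ≤ T → genStieltjesIntegral alpha F g 0 r =
      genStieltjesIntegral alpha (fun x => F (p x)) (fun x => g (p x)) 0 r := by
    intro F r hr hrT
    refine genStieltjesIntegral_congr hr (fun x hx => ?_) (fun x hx => ?_) hgc <;>
    rw [hpe x ⟨hx.1, hx.2.trans hrT⟩]
  rw [cong f₁ t (hs.trans hst) ht, cong f₂ t (hs.trans hst) ht, cong f₁ s hs (hst.trans ht),
    cong f₂ s hs (hst.trans ht),
    ← genStieltjesIntegral_add_adjacent h0 h1 hlam hbeta c₁ cg hs hst,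
    ← genStieltjesIntegral_add_adjacent h0 h1 hlam hbeta c₂ cg hs hst,
    add_sub_add_comm, add_sub_cancel_left,
    genStieltjesIntegral_sub_left h0 h1 hlam hbeta c₁ c₂ cg hst]
  -- A second clamp, to `[s, t]`: the constant `K` of the difference is available only there.
  have cl := hf.projIcc (by linarith) hK hst
  rw [genStieltjesIntegral_congr (f' := fun x => f₁ (Set.projIcc s t hst x) -
    f₂ (Set.projIcc s t hst x)) (g' := fun x => g (p x)) hst ?_ (fun _ _ => rfl) hgc]
  · have key := abs_genStieltjesIntegral_sub_le h0 h1 hlam hbeta cl cg hst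
    have e1 : (Set.projIcc s t hst s : ℝ) = s := by simp
    have e4 : (Set.projIcc 0 T hT t : ℝ) = t := hpe t ⟨hs.trans hst, ht⟩
    have e5 : (Set.projIcc 0 T hT s : ℝ) = s := hpe s ⟨hs, hst.trans ht⟩
    rw [e4, e5, e1] at key
    have e2 : |(f₁ s - f₂ s) * (g t - g s)| ≤ |f₁ s - f₂ s| * (L * (t - s) ^ beta) := by
      rw [abs_mul]
      have : |g t - g s| ≤ L * (t - s) ^ beta := hg.le hs hst ht
      gcongr
    have e3 := abs_sub_abs_le_abs_sub (genStieltjesIntegral alpha (fun x =>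
      f₁ (Set.projIcc s t hst x) - f₂ (Set.projIcc s t hst x)) (fun x => g (p x)) s t)
      ((f₁ s - f₂ s) * (g t - g s))
    rw [youngConst]
    linarith
  · intro x hx
    have e4 : (Set.projIcc 0 T hT x : ℝ) = x := hpe x ⟨hs.trans hx.1, hx.2.trans ht⟩
    rw [e4, projIcc_of_mem hst hx]

/-! ### Coordinate estimates, the four-point inequality and a contraction principle -/

section euclidean
variable {n : ℕ}

lemma EuclideanSpace.sum_smul_single (v : EuclideanSpace ℝ (Fin n)) :
    ∑ j, v j • EuclideanSpace.single j (1 : ℝ) = v := by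
  have := (EuclideanSpace.basisFun (Fin n) ℝ).sum_repr v
  simpa using this

lemma EuclideanSpace.norm_le_card_mul {v : EuclideanSpace ℝ (Fin n)} {A : ℝ}
    (h : ∀ i, |v i| ≤ A) : ‖v‖ ≤ n * A := by
  rw [← EuclideanSpace.sum_smul_single v]
  refine (norm_sum_le _ _).trans ?_
  calc ∑ j, ‖v j • EuclideanSpace.single j (1 : ℝ)‖ ≤ ∑ _j : Fin n, A := by
        refine Finset.sum_le_sum fun j _ => ?_
        rw [norm_smul, PiLp.norm_single]
        simpa using h j
    _ = n * A := by simp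

lemma EuclideanSpace.abs_apply_le (v : EuclideanSpace ℝ (Fin n)) (i : Fin n) : |v i| ≤ ‖v‖ :=
  PiLp.norm_apply_le v i
end euclidean

/-- Mean value inequality for the difference of `φ` along the segments from `y₁` to `x₁` and from
`y₂` to `x₂`. Its derivative splits into `fderiv` applied to the difference of directions (constant
`A`) and a difference of `fderiv`s applied to `x₂ - y₂` (constant `B`). -/
lemma abs_four_point_le {E : Type*} [NormedAddCommGroup E] [NormedSpace ℝ E] {φ : E → ℝ}
    (hφ : Differentiable ℝ φ) {A B : ℝ} (hA : 0 ≤ A) (hB : 0 ≤ B)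
    (h1 : ∀ x y, |φ x - φ y| ≤ A * ‖x - y‖)
    (h2 : ∀ x y v, |fderiv ℝ φ x v - fderiv ℝ φ y v| ≤ B * ‖x - y‖ * ‖v‖) (x₁ y₁ x₂ y₂ : E) :
    |(φ x₁ - φ y₁) - (φ x₂ - φ y₂)| ≤
      A * ‖(x₁ - y₁) - (x₂ - y₂)‖ + B * (‖x₁ - x₂‖ + ‖y₁ - y₂‖) * ‖x₂ - y₂‖ := by
  have hlip : LipschitzWith ⟨A, hA⟩ φ := LipschitzWith.of_dist_le_mul fun x y => by
    rw [Real.dist_eq, dist_eq_norm]; exact h1 x y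
  have hD : ∀ x v, |fderiv ℝ φ x v| ≤ A * ‖v‖ := fun x v =>
    (fderiv ℝ φ x).le_of_opNorm_le (norm_fderiv_le_of_lipschitz ℝ hlip) v
  have key := norm_image_sub_le_of_norm_deriv_le_segment_01'
    (f := fun θ : ℝ => φ (y₁ + θ • (x₁ - y₁)) - φ (y₂ + θ • (x₂ - y₂)))
    (f' := fun θ : ℝ => fderiv ℝ φ (y₁ + θ • (x₁ - y₁)) (x₁ - y₁) -
      fderiv ℝ φ (y₂ + θ • (x₂ - y₂)) (x₂ - y₂))
    (C := A * ‖(x₁ - y₁) - (x₂ - y₂)‖ + B * (‖x₁ - x₂‖ + ‖y₁ - y₂‖) * ‖x₂ - y₂‖) ?_ ?_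
  · simp only [one_smul, zero_smul, add_zero, add_sub_cancel, Real.norm_eq_abs] at key
    convert key using 2
    ring
  · intro θ _
    have line : ∀ y d : E, HasDerivAt (fun θ : ℝ => y + θ • d) d θ := fun y d => by
      simpa using ((hasDerivAt_id θ).smul_const d).const_add y
    exact (((hφ _).hasFDerivAt.comp_hasDerivAt θ (line y₁ (x₁ - y₁))).sub
      ((hφ _).hasFDerivAt.comp_hasDerivAt θ (line y₂ (x₂ - y₂)))).hasDerivWithinAt
  · intro θ hθ
    set p₁ := y₁ + θ • (x₁ - y₁)
    set p₂ := y₂ + θ • (x₂ - y₂)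
    have e1 : fderiv ℝ φ p₁ (x₁ - y₁) - fderiv ℝ φ p₂ (x₂ - y₂) =
        fderiv ℝ φ p₁ ((x₁ - y₁) - (x₂ - y₂)) +
          (fderiv ℝ φ p₁ (x₂ - y₂) - fderiv ℝ φ p₂ (x₂ - y₂)) := by
      rw [map_sub (fderiv ℝ φ p₁) (x₁ - y₁) (x₂ - y₂)]; ring
    have e2 : ‖p₁ - p₂‖ ≤ ‖x₁ - x₂‖ + ‖y₁ - y₂‖ := by
      have : p₁ - p₂ = θ • (x₁ - x₂) + (1 - θ) • (y₁ - y₂) := by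
        simp only [p₁, p₂]; module
      rw [this]
      refine (norm_add_le _ _).trans ?_
      rw [norm_smul, norm_smul, Real.norm_of_nonneg hθ.1,
        Real.norm_of_nonneg (by linarith [hθ.2] : (0 : ℝ) ≤ 1 - θ)]
      exact add_le_add (mul_le_of_le_one_left (norm_nonneg _) hθ.2.le)
        (mul_le_of_le_one_left (norm_nonneg _) (by linarith [hθ.1]))
    rw [e1]
    refine (norm_add_le _ _).trans (add_le_add (hD _ _) ((h2 _ _ _).trans ?_))
    gcongr

section vectorField
variable {n k : ℕ} {U : Fin k → EuclideanSpace ℝ (Fin n) → EuclideanSpace ℝ (Fin n)}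
  {M0 M1 M2 : Fin k → ℝ}

/-- The bound on Jacobian entries becomes a bound in all directions by expanding in the standard
basis, which costs the factor `n`. -/
lemma VectorFieldBounds.four_point (hU : VectorFieldBounds U M0 M1 M2) {m : ℝ} (hm : 0 ≤ m)
    (hM1 : ∀ γ, M1 γ ≤ m) (hM2 : ∀ γ, M2 γ ≤ m) (γ : Fin k) (i : Fin n)
    (x₁ y₁ x₂ y₂ : EuclideanSpace ℝ (Fin n)) :
    |(U γ x₁ i - U γ y₁ i) - (U γ x₂ i - U γ y₂ i)| ≤ m * ‖(x₁ - y₁) - (x₂ - y₂)‖ +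
      n * m * (‖x₁ - x₂‖ + ‖y₁ - y₂‖) * ‖x₂ - y₂‖ := by
  have hd : ∀ x, HasFDerivAt (fun x => U γ x i)
      ((EuclideanSpace.proj i : EuclideanSpace ℝ (Fin n) →L[ℝ] ℝ).comp (fderiv ℝ (U γ) x)) x :=
    fun x => (EuclideanSpace.proj i : EuclideanSpace ℝ (Fin n) →L[ℝ] ℝ).hasFDerivAt.comp x
      (hU.differentiable γ x).hasFDerivAt
  refine abs_four_point_le (fun x => (hd x).differentiableAt) hm (by positivity)
    (fun x y => (hU.lipschitz γ x y i).trans (by have := hM1 γ; gcongr)) (fun x y v => ?_) _ _ _ _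
  rw [(hd x).fderiv, (hd y).fderiv, ← EuclideanSpace.sum_smul_single v, map_sum, map_sum,
    ← Finset.sum_sub_distrib]
  refine (Finset.abs_sum_le_sum_abs _ _).trans ?_
  rw [EuclideanSpace.sum_smul_single v]
  calc _ ≤ ∑ _j : Fin n, m * ‖x - y‖ * ‖v‖ := by
        refine Finset.sum_le_sum fun j _ => ?_
        simp only [map_smul, smul_eq_mul, ← mul_sub, abs_mul]
        have e1 := EuclideanSpace.abs_apply_le v j
        have e2 : |(EuclideanSpace.proj i : EuclideanSpace ℝ (Fin n) →L[ℝ] ℝ).comp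
            (fderiv ℝ (U γ) x) (EuclideanSpace.single j 1) -
            (EuclideanSpace.proj i : EuclideanSpace ℝ (Fin n) →L[ℝ] ℝ).comp
            (fderiv ℝ (U γ) y) (EuclideanSpace.single j 1)| ≤ m * ‖x - y‖ :=
          (hU.deriv_lipschitz γ x y i j).trans (by have := hM2 γ; gcongr)
        rw [mul_comm (m * ‖x - y‖)]
        gcongr
    _ = _ := by simp; ring
end vectorField

/-- If a bound `φ ≤ K ψ` always improves to `φ ≤ (a + K / 2) ψ`, then `φ ≤ 2 a ψ`. -/
lemma le_two_mul_of_contraction {ι : Type*} {φ ψ : ι → ℝ} {a K₀ : ℝ} (ha : 0 ≤ a) (hK₀ : 0 ≤ K₀)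
    (h0 : ∀ i, φ i ≤ K₀ * ψ i)
    (hstep : ∀ K, 0 ≤ K → (∀ i, φ i ≤ K * ψ i) → ∀ i, φ i ≤ (a + K / 2) * ψ i) (i : ι) :
    φ i ≤ 2 * a * ψ i := by
  -- The map `K ↦ a + K / 2` has fixed point `2 * a`; its `N`-th iterate from `K₀` is `2 * a + (K₀ -
  -- 2 * a) / 2 ^ N`.
  have h1 : ∀ N : ℕ, ∀ i, φ i ≤ (2 * a + K₀ * (1 / 2) ^ N) * ψ i - 2 * a * (1 / 2) ^ N * ψ i := by
    intro N
    induction N with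
    | zero => intro i; have := h0 i; simp only [pow_zero]; linarith
    | succ N ih =>
      intro i
      have hN : (1 / 2 : ℝ) ^ N ≤ 1 := pow_le_one₀ (by norm_num) (by norm_num)
      have := hstep (2 * a + K₀ * (1 / 2) ^ N - 2 * a * (1 / 2) ^ N) (by
        have : 0 ≤ K₀ * (1 / 2) ^ N := by positivity
        nlinarith) (fun i => (ih i).trans (by linarith)) i
      rw [pow_succ]
      linarith
  have hp : Tendsto (fun N : ℕ => (1 / 2 : ℝ) ^ N) atTop (𝓝 0) :=
    tendsto_pow_atTop_nhds_zero_of_lt_one (by norm_num) (by norm_num)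
  have hl := (((hp.const_mul K₀).const_add (2 * a)).mul_const (ψ i)).sub
    ((hp.const_mul (2 * a)).mul_const (ψ i))
  simp only [mul_zero, add_zero, zero_mul, sub_zero] at hl
  exact ge_of_tendsto' hl fun N => h1 N i

/-! ### Increments of integral paths on a short interval -/

section increments
variable {n k : ℕ} {alpha beta T : ℝ}

/-- Extracting `(t - s) ^ lam` from the two Young-Loève terms leaves nonnegative powers of `Δ`, the
source of smallness. The a priori bound takes `f₂ = 0`; the comparison of two solutions takes `f₂ =
U (Y)`. -/
lemma norm_increment_le {lam c : ℝ} (h0 : 0 < alpha) (h1 : alpha < 1) (hlam : alpha < lam)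
    (hbeta : 1 - alpha < beta) (hlb : lam ≤ beta) (hc : c = youngConst alpha lam beta)
    {Z : ℝ → EuclideanSpace ℝ (Fin n)} {z₀ : EuclideanSpace ℝ (Fin n)}
    {f₁ f₂ : Fin k → Fin n → ℝ → ℝ} {b : Fin k → ℝ → ℝ} {l : Fin k → ℝ}
    (hZ : ∀ t ∈ Icc 0 T, ∀ i, Z t i = z₀ i + ∑ γ, (genStieltjesIntegral alpha (f₁ γ i) (b γ) 0 t -
      genStieltjesIntegral alpha (f₂ γ i) (b γ) 0 t))
    (hf₁ : ∀ γ i, ∃ C, HolderBound C lam 0 T (f₁ γ i))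
    (hf₂ : ∀ γ i, ∃ C, HolderBound C lam 0 T (f₂ γ i))
    (hl : ∀ γ, 0 ≤ l γ) (hb : ∀ γ, HolderBound (l γ) beta 0 T (b γ))
    {s t Δ A K : ℝ} (hs : 0 ≤ s) (hst : s ≤ t) (ht : t ≤ T) (hΔ : t - s ≤ Δ) (hA : 0 ≤ A)
    (hK : 0 ≤ K) (hfA : ∀ γ i, |f₁ γ i s - f₂ γ i s| ≤ A)
    (hf : ∀ γ i, HolderBound K lam s t (fun x => f₁ γ i x - f₂ γ i x)) :
    ‖Z t - Z s‖ ≤ n * ((∑ γ, l γ) * (A * Δ ^ (beta - lam) + c * K * Δ ^ beta)) * (t - s) ^ lam := by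
  have hd : 0 ≤ t - s := sub_nonneg.2 hst
  have hl0 : 0 < lam := by linarith
  have hc0 : 0 ≤ c := by
    rw [hc]; exact (mul_pos (weylConst_pos h0 h1 hlam)
      (weylConst_pos (by linarith) (by linarith) hbeta)).le
  have e1 : (t - s) ^ beta ≤ Δ ^ (beta - lam) * (t - s) ^ lam := by
    rw [show beta = (beta - lam) + lam by ring, Real.rpow_add' hd (by linarith), add_sub_cancel_right]
    gcongr
  have e2 : (t - s) ^ (lam + beta) ≤ Δ ^ beta * (t - s) ^ lam := by
    rw [Real.rpow_add' hd (by linarith), mul_comm]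
    gcongr
    linarith
  rw [mul_assoc]
  refine EuclideanSpace.norm_le_card_mul fun i => ?_
  rw [PiLp.sub_apply, hZ t ⟨hs.trans hst, ht⟩, hZ s ⟨hs, hst.trans ht⟩, add_sub_add_left_eq_sub,
    ← Finset.sum_sub_distrib]
  refine (Finset.abs_sum_le_sum_abs _ _).trans ?_
  rw [mul_assoc, Finset.sum_mul]
  refine Finset.sum_le_sum fun γ _ => ?_
  obtain ⟨C₁, hC₁⟩ := hf₁ γ i
  obtain ⟨C₂, hC₂⟩ := hf₂ γ i
  refine (abs_genStieltjesIntegral_increment_le h0 h1 hlam hbeta hC₁ hC₂ (hl γ) (hb γ) hs hst ht hK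
    (hf γ i)).trans ?_
  rw [← hc]
  have hlγ := hl γ
  calc |f₁ γ i s - f₂ γ i s| * (l γ * (t - s) ^ beta) + c * K * l γ * (t - s) ^ (lam + beta)
      ≤ A * (l γ * (Δ ^ (beta - lam) * (t - s) ^ lam)) +
        c * K * l γ * (Δ ^ beta * (t - s) ^ lam) := by
        have := hfA γ i
        gcongr
    _ = _ := by ring
end increments

/-! ### Solutions: a priori bound and Lipschitz dependence on the initial point -/

section flow
variable {n k : ℕ} {alpha beta T : ℝ}
  {U : Fin k → EuclideanSpace ℝ (Fin n) → EuclideanSpace ℝ (Fin n)} {M0 M1 M2 : Fin k → ℝ}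
  {b : Fin k → ℝ → ℝ} {l : Fin k → ℝ}

/-- `X` is a `(1 - alpha)`-Hölder solution on `[0, T]` of `X_t = x + ∑_γ ∫_0^t U_γ(X_s) db_γ(s)`. -/
structure IsDrivenPath (alpha T : ℝ)
    (U : Fin k → EuclideanSpace ℝ (Fin n) → EuclideanSpace ℝ (Fin n)) (b : Fin k → ℝ → ℝ)
    (x : EuclideanSpace ℝ (Fin n)) (X : ℝ → EuclideanSpace ℝ (Fin n)) : Prop where
  holder : ∃ C, HolderBound C (1 - alpha) 0 T X
  equation : ∀ t ∈ Icc 0 T, ∀ i,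
    X t i = x i + ∑ γ, genStieltjesIntegral alpha (fun s => U γ (X s) i) (b γ) 0 t

lemma genStieltjesIntegral_zero_left (alpha : ℝ) (g : ℝ → ℝ) (s t : ℝ) :
    genStieltjesIntegral alpha (fun _ => 0) g s t = 0 := by
  simp [genStieltjesIntegral, leftWeylDeriv]

lemma VectorFieldBounds.holderBound_comp (hU : VectorFieldBounds U M0 M1 M2) {m : ℝ}
    (hm : 0 ≤ m) (hM1 : ∀ γ, M1 γ ≤ m) {X : ℝ → EuclideanSpace ℝ (Fin n)} {C lam s t : ℝ}
    (hX : HolderBound C lam s t X) (γ : Fin k) (i : Fin n) :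
    HolderBound (m * C) lam s t (fun u => U γ (X u) i) := by
  intro u hu v hv
  refine (hU.lipschitz γ _ _ i).trans ?_
  rw [mul_assoc]
  have := hX u hu v hv
  have := hM1 γ
  gcongr

lemma IsDrivenPath.apply_zero {x : EuclideanSpace ℝ (Fin n)} {X : ℝ → EuclideanSpace ℝ (Fin n)}
    (hX : IsDrivenPath alpha T U b x X) (hT : 0 ≤ T) : X 0 = x := by
  ext i
  have := hX.equation 0 ⟨le_rfl, hT⟩ i
  simpa [genStieltjesIntegral] using this

lemma youngConst_pos {lam : ℝ} (h0 : 0 < alpha) (h1 : alpha < 1) (hlam : alpha < lam)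
    (hbeta : 1 - alpha < beta) : 0 < youngConst alpha lam beta :=
  mul_pos (weylConst_pos h0 h1 hlam) (weylConst_pos (by linarith) (by linarith) hbeta)

/-- A priori Hölder bound for solutions on a short interval. -/
lemma IsDrivenPath.holderBound (h0 : 0 < alpha) (h1 : alpha < 1 / 2) (hab : 1 < alpha + beta)
    (hU : VectorFieldBounds U M0 M1 M2) {m : ℝ} (hm : 0 ≤ m) (hM0 : ∀ γ, M0 γ ≤ m)
    (hM1 : ∀ γ, M1 γ ≤ m) (hl : ∀ γ, 0 ≤ l γ) (hb : ∀ γ, HolderBound (l γ) beta 0 T (b γ))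
    {x : EuclideanSpace ℝ (Fin n)} {X : ℝ → EuclideanSpace ℝ (Fin n)}
    (hX : IsDrivenPath alpha T U b x X) {s t Δ : ℝ} (hs : 0 ≤ s) (ht : t ≤ T)
    (hΔ0 : 0 ≤ Δ) (hΔ : t - s ≤ Δ)
    (hq : n * youngConst alpha (1 - alpha) beta * m * ((∑ γ, l γ) * Δ ^ beta) ≤ 1 / 2) :
    HolderBound (2 * (n * (∑ γ, l γ) * m * Δ ^ (beta - (1 - alpha)))) (1 - alpha) s t X := by
  -- A finite Hölder constant is needed only to start the contraction; it disappears from the final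
  -- bound.
  obtain ⟨C, hC0, hC⟩ := hX.holder.choose_spec.exists_nonneg
  have hL : 0 ≤ ∑ γ, l γ := Finset.sum_nonneg fun γ _ => hl γ
  have key := le_two_mul_of_contraction
    (ι := {p : ℝ × ℝ // s ≤ p.1 ∧ p.1 ≤ p.2 ∧ p.2 ≤ t})
    (φ := fun p => ‖X p.1.2 - X p.1.1‖) (ψ := fun p => (p.1.2 - p.1.1) ^ (1 - alpha))
    (a := n * (∑ γ, l γ) * m * Δ ^ (beta - (1 - alpha))) (K₀ := C) (by positivity) hC0
    (fun p => hC.le (hs.trans p.2.1) p.2.2.1 (p.2.2.2.trans ht)) ?_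
  · exact HolderBound.of_le fun u v hu huv hv => key ⟨(u, v), hu, huv, hv⟩
  · intro K hK hφ p
    have hXK : HolderBound K (1 - alpha) s t X :=
      HolderBound.of_le fun u v hu huv hv => hφ ⟨(u, v), hu, huv, hv⟩
    have hψ : 0 ≤ (p.1.2 - p.1.1) ^ (1 - alpha) :=
      Real.rpow_nonneg (sub_nonneg.2 p.2.2.1) _
    refine (norm_increment_le h0 (by linarith) (by linarith) (by linarith) (by linarith) rfl
      (z₀ := x) (f₁ := fun γ i s => U γ (X s) i) (f₂ := fun _ _ _ => 0) (A := m) (K := m * K)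
      (Δ := Δ) ?_ (fun γ i => ⟨_, hU.holderBound_comp hm hM1 hC γ i⟩)
      (fun γ i => ⟨0, fun u _ v _ => by simp⟩) hl hb (hs.trans p.2.1) p.2.2.1
      (p.2.2.2.trans ht) (by linarith [p.2.1, p.2.2.2]) hm (by positivity) ?_ ?_).trans ?_
    · intro r hr i
      rw [hX.equation r hr i]
      simp only [genStieltjesIntegral_zero_left, sub_zero]
    · intro γ i
      rw [sub_zero]
      exact (hU.bounded γ _ i).trans (hM0 γ)
    · intro γ i
      simp only [sub_zero]
      exact hU.holderBound_comp hm hM1 (hXK.mono p.2.1 p.2.2.2) γ i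
    · refine mul_le_mul_of_nonneg_right ?_ hψ
      have := mul_le_mul_of_nonneg_right hq hK
      linarith

/-- Two solutions at most double their distance on a short interval. -/
lemma IsDrivenPath.norm_sub_le_two_mul (h0 : 0 < alpha) (h1 : alpha < 1 / 2)
    (hab : 1 < alpha + beta) (hU : VectorFieldBounds U M0 M1 M2) {m : ℝ} (hm : 0 ≤ m)
    (hM0 : ∀ γ, M0 γ ≤ m) (hM1 : ∀ γ, M1 γ ≤ m) (hM2 : ∀ γ, M2 γ ≤ m) (hl : ∀ γ, 0 ≤ l γ)
    (hb : ∀ γ, HolderBound (l γ) beta 0 T (b γ)) {x y : EuclideanSpace ℝ (Fin n)}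
    {X Y : ℝ → EuclideanSpace ℝ (Fin n)} (hX : IsDrivenPath alpha T U b x X)
    (hY : IsDrivenPath alpha T U b y Y) {s t Δ c : ℝ} (hs : 0 ≤ s) (hst : s ≤ t) (ht : t ≤ T)
    (hΔ0 : 0 < Δ) (hΔ : t - s ≤ Δ) (hc : c = youngConst alpha (1 - alpha) beta)
    (hq1 : (∑ γ, l γ) * Δ ^ beta ≤ 1)
    (hq : n * m * (1 + c + 4 * c * n ^ 2 * m) * ((∑ γ, l γ) * Δ ^ beta) ≤ 1 / 2) :
    ‖X t - Y t‖ ≤ 2 * ‖X s - Y s‖ := by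
  have hc0 : 0 < c := hc ▸ youngConst_pos h0 (by linarith) (by linarith) (by linarith)
  have hL : 0 ≤ ∑ γ, l γ := Finset.sum_nonneg fun γ _ => hl γ
  have hbeta0 : 0 < beta := by linarith
  have hqc : n * youngConst alpha (1 - alpha) beta * m * ((∑ γ, l γ) * Δ ^ beta) ≤ 1 / 2 := by
    rw [← hc]
    refine le_trans ?_ hq
    have : n * c * m ≤ n * m * (1 + c + 4 * c * n ^ 2 * m) := by
      have : 0 ≤ n * m * (1 + 4 * c * n ^ 2 * m) := by positivity
      linarith
    gcongr
  have hKX := hX.holderBound h0 h1 hab hU hm hM0 hM1 hl hb hs ht hΔ0.le hΔ hqc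
  have hKY := hY.holderBound h0 h1 hab hU hm hM0 hM1 hl hb hs ht hΔ0.le hΔ hqc
  obtain ⟨C₁, hC₁0, hC₁⟩ := hX.holder.choose_spec.exists_nonneg
  obtain ⟨C₂, hC₂0, hC₂⟩ := hY.holder.choose_spec.exists_nonneg
  set lam := 1 - alpha with hlam
  have hlam0 : 0 < lam := by linarith
  set d := ‖X s - Y s‖ with hd
  have hd0 : 0 ≤ d := norm_nonneg _
  -- The weight `w` converts sizes into Hölder constants at scale `Δ`, and `q` is the dimensionless
  -- size of the driver.
  set w := Δ ^ (-lam) with hw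
  have hw0 : 0 < w := Real.rpow_pos_of_pos hΔ0 _
  set q := (∑ γ, l γ) * Δ ^ beta with hqdef
  have hq0 : 0 ≤ q := by positivity
  have hΔw : Δ ^ lam * w = 1 := by rw [hw, ← Real.rpow_add hΔ0, add_neg_cancel, Real.rpow_zero]
  have hLw : (∑ γ, l γ) * Δ ^ (beta - lam) = q * w := by
    rw [sub_eq_add_neg, Real.rpow_add hΔ0, hqdef]; ring
  -- With `a = d * w / 2` the difference `X - Y` gets Hölder constant `d * w`, so it moves by at
  -- most `d` over a time at most `Δ`.
  have key := le_two_mul_of_contraction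
    (ι := {p : ℝ × ℝ // s ≤ p.1 ∧ p.1 ≤ p.2 ∧ p.2 ≤ t})
    (φ := fun p => ‖(X p.1.2 - Y p.1.2) - (X p.1.1 - Y p.1.1)‖)
    (ψ := fun p => (p.1.2 - p.1.1) ^ lam)
    (a := d * w / 2) (K₀ := C₁ + C₂) (by positivity) (by positivity) ?_ ?_
  · have h2 : ‖(X t - Y t) - (X s - Y s)‖ ≤ 2 * (d * w / 2) * (t - s) ^ lam :=
      key ⟨(s, t), le_rfl, hst, le_rfl⟩
    have h3 : (t - s) ^ lam ≤ Δ ^ lam := Real.rpow_le_rpow (sub_nonneg.2 hst) hΔ hlam0.le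
    have h4 : 2 * (d * w / 2) * (t - s) ^ lam ≤ d := by
      calc _ = d * w * (t - s) ^ lam := by ring
        _ ≤ d * w * Δ ^ lam := by gcongr
        _ = d * (Δ ^ lam * w) := by ring
        _ = d := by rw [hΔw, mul_one]
    have h5 := norm_sub_norm_le (X t - Y t) (X s - Y s)
    rw [← hd] at h5
    linarith
  · intro p
    rw [sub_sub_sub_comm, add_mul]
    exact (norm_sub_le _ _).trans (add_le_add
      (hC₁.le (hs.trans p.2.1) p.2.2.1 (p.2.2.2.trans ht))
      (hC₂.le (hs.trans p.2.1) p.2.2.1 (p.2.2.2.trans ht)))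
  · intro K hK hφ p
    have hDK : HolderBound K lam s t (fun u => X u - Y u) :=
      HolderBound.of_le fun u v hu huv hv => hφ ⟨(u, v), hu, huv, hv⟩
    have hψ : 0 ≤ (p.1.2 - p.1.1) ^ lam := Real.rpow_nonneg (sub_nonneg.2 p.2.2.1) _
    -- A bound for `‖X - Y‖` on all of `[s, t]` when its Hölder constant is `K`.
    set S := d + K * Δ ^ lam with hS
    have hS0 : 0 ≤ S := by positivity
    have hSu : ∀ u ∈ Icc s t, ‖X u - Y u‖ ≤ S := by
      intro u hu
      have e1 : ‖(X u - Y u) - (X s - Y s)‖ ≤ K * (u - s) ^ lam := hDK.le le_rfl hu.1 hu.2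
      have e2 : (u - s) ^ lam ≤ Δ ^ lam :=
        Real.rpow_le_rpow (sub_nonneg.2 hu.1) (by linarith [hu.2]) hlam0.le
      have e3 := norm_sub_norm_le (X u - Y u) (X s - Y s)
      have e4 : K * (u - s) ^ lam ≤ K * Δ ^ lam := by gcongr
      rw [← hd] at e3
      linarith
    set KX := 2 * (n * (∑ γ, l γ) * m * Δ ^ (beta - lam)) with hKXdef
    have hKX0 : 0 ≤ KX := by positivity
    refine (norm_increment_le (Z := fun u => X u - Y u) h0 (by linarith) (by linarith)
      (by linarith) (by linarith) hc
      (z₀ := x - y) (f₁ := fun γ i s => U γ (X s) i) (f₂ := fun γ i s => U γ (Y s) i) (A := m * S)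
      (K := m * K + n * m * (2 * KX) * S) (Δ := Δ) ?_
      (fun γ i => ⟨_, hU.holderBound_comp hm hM1 hC₁ γ i⟩)
      (fun γ i => ⟨_, hU.holderBound_comp hm hM1 hC₂ γ i⟩) hl hb (hs.trans p.2.1) p.2.2.1
      (p.2.2.2.trans ht) (by linarith [p.2.1, p.2.2.2]) (by positivity) (by positivity)
      ?_ ?_).trans ?_
    · intro r hr i
      simp only [PiLp.sub_apply, hX.equation r hr i, hY.equation r hr i, Finset.sum_sub_distrib]
      ring
    · intro γ i
      refine (hU.lipschitz γ _ _ i).trans ?_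
      have e1 := hSu p.1.1 ⟨p.2.1, p.2.2.1.trans p.2.2.2⟩
      have e2 := hM1 γ
      gcongr
    · intro γ i u hu v hv
      have hu' : u ∈ Icc s t := ⟨p.2.1.trans hu.1, hu.2.trans p.2.2.2⟩
      have hv' : v ∈ Icc s t := ⟨p.2.1.trans hv.1, hv.2.trans p.2.2.2⟩
      refine (hU.four_point hm hM1 hM2 γ i (X u) (Y u) (X v) (Y v)).trans ?_
      have e1 := hDK u hu' v hv'
      have e2 := hKX u hu' v hv'
      have e3 := hKY u hu' v hv'
      have e4 := hSu v hv'
      have e5 : 0 ≤ |u - v| ^ lam := by positivity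
      calc _ ≤ m * (K * |u - v| ^ lam) +
            n * m * (KX * |u - v| ^ lam + KX * |u - v| ^ lam) * S := by gcongr
        _ = _ := by ring
    · refine mul_le_mul_of_nonneg_right ?_ hψ
      have hSw : S * w = d * w + K := by
        rw [hS, add_mul, mul_assoc, hΔw, mul_one]
      have hKXq : KX = 2 * n * m * (q * w) := by rw [← hLw, hKXdef]; ring
      have hKS : K ≤ S * w := by rw [hSw]; linarith [mul_nonneg hd0 hw0.le]
      -- In `1 + c + 4 * c * n ^ 2 * m` the summands come from the value at the left endpoint, from
      -- the Lipschitz part of the four-point bound, and from its second-order part with `KX = 2 * n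
      -- * m * q * w`; one spare factor `q` there is bounded by `1`.
      calc n * ((∑ γ, l γ) * (m * S * Δ ^ (beta - lam) +
            c * (m * K + n * m * (2 * KX) * S) * Δ ^ beta))
          = n * (m * S * ((∑ γ, l γ) * Δ ^ (beta - lam)) +
            c * (m * K + n * m * (2 * KX) * S) * q) := by rw [hqdef]; ring
        _ = n * m * q * (S * w + c * K + 4 * c * n ^ 2 * m * q * (S * w)) := by
            rw [hLw, hKXq]; ring
        _ ≤ n * m * q * (S * w + c * (S * w) + 4 * c * n ^ 2 * m * 1 * (S * w)) := by gcongr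
        _ = n * m * (1 + c + 4 * c * n ^ 2 * m) * q * (S * w) := by ring
        _ ≤ 1 / 2 * (S * w) := by gcongr
        _ = d * w / 2 + K / 2 := by rw [hSw]; ring

lemma IsDrivenPath.norm_sub_le_two_pow (h0 : 0 < alpha) (h1 : alpha < 1 / 2)
    (hab : 1 < alpha + beta) (hU : VectorFieldBounds U M0 M1 M2) {m : ℝ} (hm : 0 ≤ m)
    (hM0 : ∀ γ, M0 γ ≤ m) (hM1 : ∀ γ, M1 γ ≤ m) (hM2 : ∀ γ, M2 γ ≤ m) (hl : ∀ γ, 0 ≤ l γ)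
    (hb : ∀ γ, HolderBound (l γ) beta 0 T (b γ)) {x y : EuclideanSpace ℝ (Fin n)}
    {X Y : ℝ → EuclideanSpace ℝ (Fin n)} (hX : IsDrivenPath alpha T U b x X)
    (hY : IsDrivenPath alpha T U b y Y) (hT : 0 < T) {N : ℕ} (hN : 0 < N) {c : ℝ}
    (hc : c = youngConst alpha (1 - alpha) beta)
    (hq1 : (∑ γ, l γ) * (T / N) ^ beta ≤ 1)
    (hq : n * m * (1 + c + 4 * c * n ^ 2 * m) * ((∑ γ, l γ) * (T / N) ^ beta) ≤ 1 / 2)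
    {t : ℝ} (ht : t ∈ Icc 0 T) : ‖X t - Y t‖ ≤ 2 ^ N * ‖x - y‖ := by
  have hN' : (0 : ℝ) < N := Nat.cast_pos.2 hN
  have hΔ : 0 < T / N := by positivity
  have key : ∀ j : ℕ, ∀ t ∈ Icc 0 T, t ≤ j * (T / N) → ‖X t - Y t‖ ≤ 2 ^ j * ‖x - y‖ := by
    intro j
    induction j with
    | zero =>
      intro t ht htj
      have : t = 0 := le_antisymm (by simpa using htj) ht.1
      rw [this, hX.apply_zero hT.le, hY.apply_zero hT.le, pow_zero, one_mul]
    | succ j ih =>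
      intro t ht htj
      push_cast at htj
      -- The minimum is the end of the `j`-th piece, or `t` itself if `t` comes earlier.
      have hs0 : 0 ≤ min t (j * (T / N)) := le_min ht.1 (by positivity)
      have := hX.norm_sub_le_two_mul h0 h1 hab hU hm hM0 hM1 hM2 hl hb hY hs0 (min_le_left _ _)
        ht.2 hΔ (by rcases min_choice t (j * (T / N)) with h | h <;> rw [h] <;> linarith) hc hq1 hq
      have h2 := ih (min t (j * (T / N))) ⟨hs0, (min_le_left _ _).trans ht.2⟩ (min_le_right _ _)
      rw [pow_succ]
      linarith
  refine key N t ht ?_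
  rw [mul_div_cancel₀ _ hN'.ne']
  exact ht.2

lemma IsDrivenFlow.isDrivenPath {Φ : ℝ → EuclideanSpace ℝ (Fin n) → EuclideanSpace ℝ (Fin n)}
    (h : IsDrivenFlow alpha T U b Φ) (x : EuclideanSpace ℝ (Fin n)) :
    IsDrivenPath alpha T U b x (fun t => Φ t x) where
  holder := (h.holder x).imp fun _ hC u hu v hv => hC v hv u hu
  equation := h.equation x
end flow

/-! ### Hölder norms: attainment of the bound and measurability -/

section holderNorm
variable {E : Type*} [NormedAddCommGroup E] {lam a b K : ℝ} {f : ℝ → E}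

/-- The set of Hölder quotients whose supremum is the Hölder norm. -/
def holderQuotients (lam a b : ℝ) (f : ℝ → E) : Set ℝ :=
  {r : ℝ | ∃ c d : ℝ, a ≤ c ∧ c ≤ d ∧ d ≤ b ∧ r = ‖f d - f c‖ / |d - c| ^ lam}

lemma holderNorm_nonneg : 0 ≤ holderNorm lam a b f :=
  Real.sSup_nonneg (by rintro r ⟨c, d, -, -, -, rfl⟩; positivity)

lemma HolderBound.quotient_le (hK : 0 ≤ K) (hf : HolderBound K lam a b f) :
    ∀ r ∈ holderQuotients lam a b f, r ≤ K := by
  rintro r ⟨c, d, hc, hcd, hd, rfl⟩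
  exact div_le_of_le_mul₀ (by positivity) hK (hf d ⟨hc.trans hcd, hd⟩ c ⟨hc, hcd.trans hd⟩)

lemma HolderBound.bddAbove (hK : 0 ≤ K) (hf : HolderBound K lam a b f) :
    BddAbove (holderQuotients lam a b f) := ⟨K, hf.quotient_le hK⟩

lemma HolderBound.holderNorm_le (hK : 0 ≤ K) (hf : HolderBound K lam a b f) :
    holderNorm lam a b f ≤ K := Real.sSup_le (hf.quotient_le hK) hK

/-- Boundedness matters: `sSup` of an unbounded set of reals is `0`. -/
lemma holderBound_holderNorm (h : BddAbove (holderQuotients lam a b f)) :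
    HolderBound (holderNorm lam a b f) lam a b f := by
  refine HolderBound.of_le fun s t hs hst ht => ?_
  rcases hst.eq_or_lt with rfl | hlt
  · rw [sub_self, norm_zero]
    exact mul_nonneg holderNorm_nonneg (Real.rpow_nonneg (by linarith) _)
  · have hp : 0 < t - s := sub_pos.2 hlt
    rw [← div_le_iff₀ (Real.rpow_pos_of_pos hp _)]
    refine le_csSup h ⟨s, t, hs, hst, ht, ?_⟩
    rw [abs_of_pos hp]

/-- Off the diagonal the quotient is continuous in both times, so rational pairs clamped to `[a, b]`
exhaust the supremum. -/
lemma holderNorm_eq_iSup_rat (hlam : 0 < lam) (hab : a ≤ b) (hf : ContinuousOn f (Icc a b))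
    (h : BddAbove (holderQuotients lam a b f)) :
    holderNorm lam a b f = ⨆ q : ℚ × ℚ, ‖f (projIcc a b hab q.2) - f (projIcc a b hab q.1)‖ /
      |(projIcc a b hab q.2 : ℝ) - projIcc a b hab q.1| ^ lam := by
  set φ : ℝ × ℝ → ℝ := fun z => ‖f (projIcc a b hab z.2) - f (projIcc a b hab z.1)‖ /
      |(projIcc a b hab z.2 : ℝ) - projIcc a b hab z.1| ^ lam with hφ
  have hle : ∀ z, φ z ≤ holderNorm lam a b f := fun z =>
    (holderBound_holderNorm h).quotient_le holderNorm_nonneg _ (by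
      rcases le_total (projIcc a b hab z.1 : ℝ) (projIcc a b hab z.2) with h1 | h1
      · exact ⟨_, _, (projIcc a b hab z.1).2.1, h1, (projIcc a b hab z.2).2.2, rfl⟩
      · refine ⟨_, _, (projIcc a b hab z.2).2.1, h1, (projIcc a b hab z.1).2.2, ?_⟩
        rw [hφ, norm_sub_rev, abs_sub_comm])
  have hb : BddAbove (range fun q : ℚ × ℚ => φ (q.1, q.2)) :=
    ⟨_, by rintro _ ⟨q, rfl⟩; exact hle _⟩
  have hF : Continuous fun x => f (projIcc a b hab x) :=
    hf.comp_continuous (continuous_subtype_val.comp continuous_projIcc) fun x =>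
      (projIcc a b hab x).2
  have hp : Continuous fun x => (projIcc a b hab x : ℝ) :=
    continuous_subtype_val.comp continuous_projIcc
  change _ = ⨆ q : ℚ × ℚ, φ (q.1, q.2)
  have hsup0 : 0 ≤ ⨆ q : ℚ × ℚ, φ (q.1, q.2) := Real.iSup_nonneg fun q => by positivity
  refine le_antisymm (Real.sSup_le ?_ hsup0) (ciSup_le fun q => hle _)
  rintro r ⟨c, d, hc, hcd, hd, rfl⟩
  rcases hcd.eq_or_lt with rfl | hlt
  · simpa using hsup0
  by_contra! hcon
  have hz : ‖f d - f c‖ / |d - c| ^ lam = φ (c, d) := by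
    simp only [hφ, projIcc_of_mem hab (⟨hc, hcd.trans hd⟩ : c ∈ Icc a b),
      projIcc_of_mem hab (⟨hc.trans hcd, hd⟩ : d ∈ Icc a b)]
  have hcont : ContinuousAt φ (c, d) := by
    have h1 : Continuous fun z : ℝ × ℝ =>
        ‖f (projIcc a b hab z.2) - f (projIcc a b hab z.1)‖ :=
      ((hF.comp continuous_snd).sub (hF.comp continuous_fst)).norm
    have h2 : Continuous fun z : ℝ × ℝ =>
        |(projIcc a b hab z.2 : ℝ) - projIcc a b hab z.1| ^ lam :=
      ((hp.comp continuous_snd).sub (hp.comp continuous_fst)).abs.rpow_const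
        fun _ => Or.inr hlam.le
    refine h1.continuousAt.div h2.continuousAt ?_
    simp only [projIcc_of_mem hab (⟨hc, hcd.trans hd⟩ : c ∈ Icc a b),
      projIcc_of_mem hab (⟨hc.trans hcd, hd⟩ : d ∈ Icc a b)]
    exact (Real.rpow_pos_of_pos (abs_pos.2 (sub_pos.2 hlt).ne') _).ne'
  rw [hz] at hcon
  have hev := hcont.eventually (lt_mem_nhds hcon)
  have hdense : DenseRange (fun q : ℚ × ℚ => ((q.1 : ℝ), (q.2 : ℝ))) :=
    Rat.denseRange_cast.prodMap Rat.denseRange_cast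
  obtain ⟨V, hV, hVo, hVm⟩ := eventually_nhds_iff.1 hev
  obtain ⟨q, hq⟩ := hdense.exists_mem_open hVo ⟨_, hVm⟩
  exact absurd (hV _ hq) (not_lt.2 (le_ciSup hb q))

lemma aemeasurable_holderNorm {Ω : Type*} [MeasurableSpace Ω] {P : Measure Ω}
    {X : ℝ → Ω → E} (hlam : 0 < lam) (hab : a ≤ b)
    (hX : ∀ t ∈ Icc a b, AEStronglyMeasurable (X t) P)
    (hc : ∀ᵐ ω ∂P, ContinuousOn (fun t => X t ω) (Icc a b))
    (hb : ∀ᵐ ω ∂P, BddAbove (holderQuotients lam a b fun t => X t ω)) :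
    AEMeasurable (fun ω => holderNorm lam a b fun t => X t ω) P := by
  have h1 : AEMeasurable (fun ω => ⨆ q : ℚ × ℚ,
      ‖X (projIcc a b hab q.2) ω - X (projIcc a b hab q.1) ω‖ /
        |(projIcc a b hab q.2 : ℝ) - projIcc a b hab q.1| ^ lam) P :=
    AEMeasurable.iSup fun q => (((hX _ (projIcc a b hab q.2).2).sub
      (hX _ (projIcc a b hab q.1).2)).norm.aemeasurable).div_const _
  refine h1.congr ?_
  filter_upwards [hc, hb] with ω hω hbω
  exact (holderNorm_eq_iSup_rat hlam hab hω hbω).symm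
end holderNorm

/-! ### Dyadic chaining -/

section chaining
variable {f : ℝ → ℝ} {T : ℝ} {D : ℕ → ℝ}

/-- The largest dyadic point of `[0, T]` of level `j` that is at most `t`. -/
noncomputable def dyadicFloor (T : ℝ) (j : ℕ) (t : ℝ) : ℝ := ⌊t * 2 ^ j / T⌋₊ * (T / 2 ^ j)

lemma abs_sub_le_of_floor {j A B : ℕ} (hD : ∀ j, 0 ≤ D j)
    (h : ∀ j, ∀ i < 2 ^ j, |f ((i + 1 : ℕ) * (T / 2 ^ j)) - f (i * (T / 2 ^ j))| ≤ D j)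
    (hAB : A ≤ B) (hBA : B ≤ A + 1) (hB : B ≤ 2 ^ j) :
    |f (B * (T / 2 ^ j)) - f (A * (T / 2 ^ j))| ≤ D j := by
  rcases hAB.eq_or_lt with rfl | hlt
  · simpa using hD j
  · obtain rfl : B = A + 1 := by omega
    exact h j A (by omega)

lemma floor_le_two_pow (hT : 0 < T) {t : ℝ} (ht : t ∈ Icc 0 T) (j : ℕ) :
    ⌊t * 2 ^ j / T⌋₊ ≤ 2 ^ j := by
  refine Nat.floor_le_of_le ?_
  rw [div_le_iff₀ hT]
  push_cast
  have := mul_le_mul_of_nonneg_right ht.2 (show (0 : ℝ) ≤ 2 ^ j by positivity)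
  linarith

lemma abs_dyadicFloor_succ_sub_le (hT : 0 < T) (hD : ∀ j, 0 ≤ D j)
    (h : ∀ j, ∀ i < 2 ^ j, |f ((i + 1 : ℕ) * (T / 2 ^ j)) - f (i * (T / 2 ^ j))| ≤ D j)
    {t : ℝ} (ht : t ∈ Icc 0 T) (j : ℕ) :
    |f (dyadicFloor T (j + 1) t) - f (dyadicFloor T j t)| ≤ D (j + 1) := by
  have hx : 0 ≤ t * 2 ^ j / T := div_nonneg (mul_nonneg ht.1 (by positivity)) hT.le
  have e1 : t * 2 ^ (j + 1) / T = 2 * (t * 2 ^ j / T) := by rw [pow_succ]; ring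
  -- The level `j` point has even index at level `j + 1`, and the level `j + 1` floor exceeds that
  -- index by `0` or `1`.
  have e2 : dyadicFloor T j t = (2 * ⌊t * 2 ^ j / T⌋₊ : ℕ) * (T / 2 ^ (j + 1)) := by
    rw [dyadicFloor, pow_succ]; push_cast; field_simp
  rw [e2, dyadicFloor]
  refine abs_sub_le_of_floor hD h ?_ ?_ (floor_le_two_pow hT ht (j + 1))
  · rw [e1]
    refine Nat.le_floor ?_
    push_cast
    linarith [Nat.floor_le hx]
  · rw [e1, ← Nat.lt_succ_iff, Nat.floor_lt (by positivity)]
    push_cast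
    linarith [Nat.lt_floor_add_one (t * 2 ^ j / T)]

lemma tendsto_dyadicFloor (hT : 0 < T) {t : ℝ} (ht : t ∈ Icc 0 T) :
    Tendsto (fun j => dyadicFloor T j t) atTop (𝓝[Icc 0 T] t) := by
  have hle : ∀ j, dyadicFloor T j t ≤ t := fun j => by
    have hx : 0 ≤ t * 2 ^ j / T := div_nonneg (mul_nonneg ht.1 (by positivity)) hT.le
    have := mul_le_mul_of_nonneg_right (Nat.floor_le hx) (show 0 ≤ T / 2 ^ j by positivity)
    refine this.trans (le_of_eq ?_)
    field_simp
  have hge : ∀ j, t - T * (1 / 2) ^ j ≤ dyadicFloor T j t := fun j => by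
    have := mul_le_mul_of_nonneg_right (Nat.lt_floor_add_one (t * 2 ^ j / T)).le
      (show 0 ≤ T / 2 ^ j by positivity)
    have e1 : t * 2 ^ j / T * (T / 2 ^ j) = t := by field_simp
    have e2 : T * (1 / 2) ^ j = T / 2 ^ j := by rw [one_div, inv_pow]; rfl
    rw [e1, add_mul, one_mul] at this
    rw [e2, dyadicFloor]
    linarith
  refine tendsto_nhdsWithin_iff.2 ⟨?_, Eventually.of_forall fun j =>
    ⟨by unfold dyadicFloor; positivity, (hle j).trans ht.2⟩⟩
  refine tendsto_of_tendsto_of_tendsto_of_le_of_le ?_ tendsto_const_nhds hge hle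
  have := (tendsto_pow_atTop_nhds_zero_of_lt_one (r := (1 / 2 : ℝ)) (by norm_num)
    (by norm_num)).const_mul T
  simpa using this.const_sub t

lemma abs_sub_dyadicFloor_le (hT : 0 < T) (hf : ContinuousOn f (Icc 0 T)) (hD : ∀ j, 0 ≤ D j)
    (hs : Summable D)
    (h : ∀ j, ∀ i < 2 ^ j, |f ((i + 1 : ℕ) * (T / 2 ^ j)) - f (i * (T / 2 ^ j))| ≤ D j)
    {t : ℝ} (ht : t ∈ Icc 0 T) (m : ℕ) :
    |f t - f (dyadicFloor T m t)| ≤ ∑' j, D (m + j + 1) := by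
  have := dist_le_tsum_of_dist_le_of_tendsto (f := fun j => f (dyadicFloor T j t))
    (fun j => D (j + 1)) (fun j => by
      rw [dist_comm, Real.dist_eq]; exact abs_dyadicFloor_succ_sub_le hT hD h ht j)
    ((summable_nat_add_iff 1).2 hs) ((hf t ht).tendsto.comp (tendsto_dyadicFloor hT ht)) m
  rwa [dist_comm, Real.dist_eq] at this

/-- Chaining along dyadic points: summable control of dyadic increments gives a Hölder bound. -/
lemma holderBound_of_dyadic_increments {beta : ℝ} (hbeta : 0 < beta) (hT : 0 < T)
    (hf : ContinuousOn f (Icc 0 T)) (hD : ∀ j, 0 ≤ D j)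
    (hs : Summable fun j : ℕ => ((2 : ℝ) ^ beta) ^ j * D j)
    (h : ∀ j, ∀ i < 2 ^ j, |f ((i + 1 : ℕ) * (T / 2 ^ j)) - f (i * (T / 2 ^ j))| ≤ D j) :
    HolderBound (2 * (2 / T) ^ beta * ∑' j : ℕ, ((2 : ℝ) ^ beta) ^ j * D j) beta 0 T f := by
  have hρ : (1 : ℝ) ≤ 2 ^ beta := Real.one_le_rpow (by norm_num) hbeta.le
  set ρ : ℝ := 2 ^ beta with hρdef
  have hρ0 : 0 < ρ := by linarith
  have hsD : Summable D := Summable.of_nonneg_of_le hD (fun j =>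
    le_mul_of_one_le_left (hD j) (one_le_pow₀ hρ)) hs
  have hterm : ∀ j : ℕ, 0 ≤ ρ ^ j * D j := fun j => mul_nonneg (by positivity) (hD j)
  refine HolderBound.of_le fun s t hs0 hst ht => ?_
  rcases hst.eq_or_lt with rfl | hlt
  · rw [sub_self, sub_self, norm_zero, Real.zero_rpow hbeta.ne', mul_zero]
  have hp : 0 < t - s := sub_pos.2 hlt
  have hsm : s ∈ Icc 0 T := ⟨hs0, hst.trans ht⟩
  have htm : t ∈ Icc 0 T := ⟨hs0.trans hst, ht⟩
  -- The scale satisfies `2 ^ (-(m + 1)) < (t - s) / T ≤ 2 ^ (-m)`: the upper bound makes the level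
  -- `m` floors equal or adjacent, the lower bound yields the factor `(2 / T) ^ beta`.
  obtain ⟨m, hm1, hm2⟩ := exists_nat_pow_near_of_lt_one (y := (1 / 2 : ℝ)) (x := (t - s) / T)
    (by positivity) (by rw [div_le_one hT]; linarith) (by norm_num) (by norm_num)
  have hmid : |f (dyadicFloor T m t) - f (dyadicFloor T m s)| ≤ D m := by
    have hx : 0 ≤ s * 2 ^ m / T := div_nonneg (mul_nonneg hs0 (by positivity)) hT.le
    have hle : s * 2 ^ m / T ≤ t * 2 ^ m / T := by gcongr
    refine abs_sub_le_of_floor hD h (Nat.floor_mono hle) ?_ (floor_le_two_pow hT htm m)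
    rw [← Nat.floor_add_one hx]
    refine Nat.floor_mono ?_
    have : (t - s) / T * 2 ^ m ≤ 1 := by
      calc _ ≤ (1 / 2 : ℝ) ^ m * 2 ^ m := by gcongr
        _ = 1 := by rw [← mul_pow]; norm_num
    have e : t * 2 ^ m / T = s * 2 ^ m / T + (t - s) / T * 2 ^ m := by ring
    linarith
  have hsm' := abs_sub_dyadicFloor_le hT hf hD hsD h hsm m
  have htm' := abs_sub_dyadicFloor_le hT hf hD hsD h htm m
  have hsum1 : Summable fun j => D (m + j) := by
    simpa only [add_comm m] using (summable_nat_add_iff m).2 hsD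
  have hsum2 : D m + ∑' j, D (m + j + 1) = ∑' j, D (m + j) := by
    rw [hsum1.tsum_eq_zero_add]; rfl
  have hsum3 : ∑' j, D (m + j) ≤ (ρ ^ m)⁻¹ * ∑' j, ρ ^ j * D j := by
    have hs' : Summable fun j => ρ ^ (m + j) * D (m + j) := by
      simpa only [add_comm m] using (summable_nat_add_iff m).2 hs
    have e1 : ∑' j, ρ ^ (m + j) * D (m + j) ≤ ∑' j, ρ ^ j * D j :=
      (hs'.tsum_le_tsum_of_inj (fun j => m + j) (fun _ _ hij => by simpa using hij)
        (fun j _ => hterm j) (fun j => le_rfl) hs)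
    rw [le_inv_mul_iff₀ (by positivity), ← tsum_mul_left]
    refine le_trans (Summable.tsum_le_tsum (fun j => ?_) (hsum1.mul_left _) hs') e1
    rw [pow_add]
    have : 1 ≤ ρ ^ j := one_le_pow₀ hρ
    have h3 : 0 ≤ ρ ^ m * D (m + j) := mul_nonneg (by positivity) (hD _)
    nlinarith
  have hpow : (ρ ^ m)⁻¹ ≤ (2 / T) ^ beta * (t - s) ^ beta := by
    rw [← Real.mul_rpow (by positivity) hp.le, hρdef, ← Real.rpow_natCast, ← Real.rpow_mul
      (by norm_num), mul_comm beta, Real.rpow_mul (by norm_num), ← Real.inv_rpow (by positivity),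
      Real.rpow_natCast]
    refine Real.rpow_le_rpow (by positivity) ?_ hbeta.le
    rw [pow_succ] at hm1
    rw [← inv_pow, ← one_div]
    have e : 2 / T * (t - s) = 2 * ((t - s) / T) := by ring
    rw [e]
    linarith
  have hnn : 0 ≤ ∑' j, ρ ^ j * D j := tsum_nonneg hterm
  have hDm := hD m
  calc ‖f t - f s‖ ≤ |f t - f (dyadicFloor T m t)| +
        |f (dyadicFloor T m t) - f (dyadicFloor T m s)| + |f s - f (dyadicFloor T m s)| := by
        rw [Real.norm_eq_abs, abs_sub_comm (f s)]
        refine le_trans (le_of_eq ?_) (abs_add_three _ _ _)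
        congr 1; ring
    _ ≤ 2 * ∑' j, D (m + j) := by linarith
    _ ≤ 2 * ((ρ ^ m)⁻¹ * ∑' j, ρ ^ j * D j) := by linarith
    _ ≤ 2 * (((2 / T) ^ beta * (t - s) ^ beta) * ∑' j, ρ ^ j * D j) := by gcongr
    _ = _ := by ring
end chaining

/-! ### Integrable Hölder bounds for fractional Brownian motion -/

section fbm
variable {Ω : Type*} [MeasurableSpace Ω] {P : Measure Ω} {H : ℝ} {X : ℝ → Ω → ℝ}

/-- A series of nonnegative functions with summable integrals converges almost everywhere and has
an integrable sum. -/
lemma ae_summable_and_integrable_tsum {G : ℕ → Ω → ℝ} (h0 : ∀ j ω, 0 ≤ G j ω)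
    (hi : ∀ j, Integrable (G j) P) (hs : Summable fun j => ∫ ω, G j ω ∂P) :
    (∀ᵐ ω ∂P, Summable fun j => G j ω) ∧ Integrable (fun ω => ∑' j, G j ω) P := by
  have hm : ∀ j, AEMeasurable (fun ω => ENNReal.ofReal (G j ω)) P := fun j =>
    (hi j).aemeasurable.ennreal_ofReal
  have hfin : ∫⁻ ω, ∑' j, ENNReal.ofReal (G j ω) ∂P ≠ ∞ := by
    rw [lintegral_tsum hm]
    simp only [← ofReal_integral_eq_lintegral_ofReal (hi _) (ae_of_all _ (h0 _))]
    exact hs.tsum_ofReal_ne_top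
  have hae := ae_lt_top' (AEMeasurable.tsum hm) hfin
  have hsum : ∀ᵐ ω ∂P, Summable fun j => G j ω := by
    filter_upwards [hae] with ω hω
    have := ENNReal.summable_toReal hω.ne
    simpa only [ENNReal.toReal_ofReal (h0 _ ω)] using this
  refine ⟨hsum, (integrable_toReal_of_lintegral_ne_top (AEMeasurable.tsum hm) hfin).congr ?_⟩
  filter_upwards [hsum] with ω hω
  rw [← ENNReal.ofReal_tsum_of_nonneg (fun j => h0 j ω) hω,
    ENNReal.toReal_ofReal (tsum_nonneg fun j => h0 j ω)]

/-- The absolute moments of the standard Gaussian distribution. -/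
noncomputable def gaussianAbsMoment (p : ℕ) : ℝ := ∫ x, |x| ^ p ∂(gaussianReal 0 1)

lemma IsFractionalBrownianMotion.hasGaussianLaw_sub (hX : IsFractionalBrownianMotion H X P)
    {s t : ℝ} (hs : 0 ≤ s) (ht : 0 ≤ t) : HasGaussianLaw (fun ω => X t ω - X s ω) P :=
  hX.gaussian.hasGaussianLaw_fun_sub (s := ⟨t, ht⟩) (t := ⟨s, hs⟩)

lemma IsFractionalBrownianMotion.hasGaussianLaw (hX : IsFractionalBrownianMotion H X P)
    {t : ℝ} (ht : 0 ≤ t) : HasGaussianLaw (X t) P :=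
  hX.gaussian.hasGaussianLaw_eval ⟨t, ht⟩

lemma IsFractionalBrownianMotion.map_sub (hX : IsFractionalBrownianMotion H X P) (hH : 0 < H)
    {s t : ℝ} (hs : 0 ≤ s) (ht : 0 ≤ t) :
    P.map (fun ω => X t ω - X s ω) =
      (gaussianReal 0 1).map (fun x => |t - s| ^ H * x) := by
  have hl := hX.hasGaussianLaw_sub hs ht
  have := hl.isProbabilityMeasure
  have lt := hX.hasGaussianLaw ht
  have ls := hX.hasGaussianLaw hs
  rw [hl.map_eq_gaussianReal, gaussianReal_map_const_mul, mul_zero, mul_one]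
  congr 1
  · rw [integral_sub lt.integrable ls.integrable, hX.mean_zero t ht, hX.mean_zero s hs, sub_zero]
  · rw [← covariance_self hl.aemeasurable, covariance_fun_sub_fun_sub lt.memLp_two ls.memLp_two
      lt.memLp_two ls.memLp_two, hX.covariance_eq t t ht ht, hX.covariance_eq t s ht hs,
      hX.covariance_eq s t hs ht, hX.covariance_eq s s hs hs]
    ext
    rw [Real.coe_toNNReal', NNReal.coe_mk, ← Real.rpow_natCast, ← Real.rpow_mul (abs_nonneg _),
      abs_sub_comm s t, sub_self, sub_self, abs_zero, Real.zero_rpow (by linarith)]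
    rw [max_eq_left]
    · rw [mul_comm H]; push_cast; ring
    · have : 0 ≤ |t - s| ^ (2 * H) := by positivity
      linarith

lemma IsFractionalBrownianMotion.integrable_abs_sub_pow (hX : IsFractionalBrownianMotion H X P)
    {s t : ℝ} (hs : 0 ≤ s) (ht : 0 ≤ t) (p : ℕ) :
    Integrable (fun ω => |X t ω - X s ω| ^ p) P := by
  have hl := hX.hasGaussianLaw_sub hs ht
  have := hl.isProbabilityMeasure
  exact (hl.memLp (p := p) (by simp)).integrable_norm_pow'

lemma IsFractionalBrownianMotion.integral_abs_sub_pow (hX : IsFractionalBrownianMotion H X P)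
    (hH : 0 < H) {s t : ℝ} (hs : 0 ≤ s) (ht : 0 ≤ t) (p : ℕ) :
    ∫ ω, |X t ω - X s ω| ^ p ∂P = (|t - s| ^ H) ^ p * gaussianAbsMoment p := by
  have hl := hX.hasGaussianLaw_sub hs ht
  have h1 := integral_map (f := fun x : ℝ => |x| ^ p) hl.aemeasurable
    (Measurable.aestronglyMeasurable (by fun_prop))
  rw [← h1, hX.map_sub hH hs ht, integral_map (by fun_prop)
    (Measurable.aestronglyMeasurable (by fun_prop)), gaussianAbsMoment, ← integral_const_mul]
  congr 1
  ext x
  rw [abs_mul, mul_pow, abs_of_nonneg (show 0 ≤ |t - s| ^ H by positivity)]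

/-- Bounds a maximum of many increments by a threshold plus a sum of high powers, whose expectation
is explicit, with no root to take. -/
lemma le_add_pow_div_pow {x δ : ℝ} (hx : 0 ≤ x) (hδ : 0 < δ) (q : ℕ) :
    x ≤ δ + x ^ (q + 1) / δ ^ q := by
  rcases le_total x δ with h | h
  · have : 0 ≤ x ^ (q + 1) / δ ^ q := by positivity
    linarith
  · have : x ≤ x ^ (q + 1) / δ ^ q := by
      rw [le_div_iff₀ (by positivity), pow_succ, mul_comm]
      gcongr
    linarith

/-- The Hölder norms of fractional Brownian motion of order less than the Hurst parameter are
almost surely dominated by an integrable random variable. -/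
lemma IsFractionalBrownianMotion.exists_integrable_holderBound
    (hX : IsFractionalBrownianMotion H X P) {beta T : ℝ} (hbeta : 0 < beta) (hH : beta < H)
    (hT : 0 < T) : ∃ S : Ω → ℝ, (∀ ω, 0 ≤ S ω) ∧ Integrable S P ∧
      ∀ᵐ ω ∂P, HolderBound (S ω) beta 0 T fun t => X t ω := by
  have hH0 : 0 < H := by linarith
  have := (hX.hasGaussianLaw le_rfl).isProbabilityMeasure
  -- The threshold at level `j` is `2 ^ (-θ * j)`. It is summable against `2 ^ (beta * j)` as `beta
  -- < θ`; the moment term has ratio `2 ^ (1 - q * (H - θ) + beta - H) < 1` once `q * (H - θ) ≥ 1`.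
  set θ := (beta + H) / 2 with hθ
  obtain ⟨q, hq⟩ := exists_nat_ge (1 / (H - θ))
  rw [div_le_iff₀ (by linarith)] at hq
  set d : ℝ := 2 ^ (-θ) with hd
  have hd0 : 0 < d := by positivity
  set ρ : ℝ := 2 ^ beta with hρ
  have hρ0 : 0 < ρ := by positivity
  set D : ℕ → Ω → ℝ := fun j ω => d ^ j + (∑ i ∈ Finset.range (2 ^ j),
    |X ((i + 1 : ℕ) * (T / 2 ^ j)) ω - X (i * (T / 2 ^ j)) ω| ^ (q + 1)) / (d ^ j) ^ q with hD
  have hD0 : ∀ j ω, 0 ≤ D j ω := fun j ω => by positivity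
  have hpt : ∀ i j : ℕ, 0 ≤ (i : ℝ) * (T / 2 ^ j) := fun i j => by positivity
  have hint : ∀ j i : ℕ, Integrable (fun ω => |X ((i + 1 : ℕ) * (T / 2 ^ j)) ω -
      X (i * (T / 2 ^ j)) ω| ^ (q + 1)) P := fun j i =>
    hX.integrable_abs_sub_pow (hpt _ _) (hpt _ _) _
  have hsumint : ∀ j : ℕ, Integrable (fun ω => ∑ i ∈ Finset.range (2 ^ j),
    |X ((i + 1 : ℕ) * (T / 2 ^ j)) ω - X (i * (T / 2 ^ j)) ω| ^ (q + 1)) P := fun j =>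
    integrable_finsetSum _ fun i _ => hint j i
  have hDi : ∀ j, Integrable (fun ω => ρ ^ j * D j ω) P := fun j =>
    (((integrable_const (d ^ j)).add ((hsumint j).div_const _)).const_mul _)
  have hDint : ∀ j, ∫ ω, ρ ^ j * D j ω ∂P = (ρ * d) ^ j +
      (T ^ H) ^ (q + 1) * gaussianAbsMoment (q + 1) *
        (2 * ρ / (d ^ q * (2 ^ H) ^ (q + 1))) ^ j := by
    intro j
    rw [integral_const_mul, integral_add (integrable_const _) ((hsumint j).div_const _),
      integral_const, integral_div, integral_finsetSum _ fun i _ => hint j i]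
    have e1 : ∀ i ∈ Finset.range (2 ^ j), ∫ ω, |X ((i + 1 : ℕ) * (T / 2 ^ j)) ω -
        X (i * (T / 2 ^ j)) ω| ^ (q + 1) ∂P =
        (T ^ H / (2 ^ H) ^ j) ^ (q + 1) * gaussianAbsMoment (q + 1) := fun i _ => by
      rw [hX.integral_abs_sub_pow hH0 (hpt _ _) (hpt _ _)]
      congr 2
      rw [← sub_mul]
      push_cast
      rw [add_sub_cancel_left, one_mul, abs_of_pos (by positivity),
        Real.div_rpow hT.le (by positivity), ← Real.rpow_natCast, ← Real.rpow_mul (by norm_num),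
        ← Real.rpow_natCast, ← Real.rpow_mul (by norm_num), mul_comm H]
    rw [Finset.sum_congr rfl e1]
    simp only [probReal_univ, one_smul, Finset.sum_const, Finset.card_range, nsmul_eq_mul,
      mul_pow, div_pow, Nat.cast_pow, Nat.cast_ofNat, mul_add]
    congr 1
    rw [← pow_mul, ← pow_mul, ← pow_mul, ← pow_mul, mul_comm q j, mul_comm (q + 1) j]
    field_simp
  have hr1 : ρ * d < 1 := by
    rw [hρ, hd, ← Real.rpow_add (by norm_num)]
    exact Real.rpow_lt_one_of_one_lt_of_neg (by norm_num) (by linarith)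
  have hr2 : 2 * ρ / (d ^ q * (2 ^ H) ^ (q + 1)) < 1 := by
    have : 2 * ρ / (d ^ q * (2 ^ H) ^ (q + 1)) =
        2 ^ (1 + beta - (-θ * q + H * (q + 1 : ℕ))) := by
      rw [Real.rpow_sub (by norm_num), Real.rpow_add (by norm_num), Real.rpow_add (by norm_num),
        Real.rpow_one, Real.rpow_mul (by norm_num), Real.rpow_mul (by norm_num),
        Real.rpow_natCast, Real.rpow_natCast]
    rw [this]
    refine Real.rpow_lt_one_of_one_lt_of_neg (by norm_num) ?_
    push_cast
    linarith
  have hsum : Summable fun j => ∫ ω, ρ ^ j * D j ω ∂P := by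
    simp only [hDint]
    exact (summable_geometric_of_lt_one (by positivity) hr1).add
      ((summable_geometric_of_lt_one (by positivity) hr2).mul_left _)
  obtain ⟨has, hai⟩ := ae_summable_and_integrable_tsum
    (fun j ω => mul_nonneg (by positivity) (hD0 j ω)) hDi hsum
  refine ⟨fun ω => 2 * (2 / T) ^ beta * ∑' j, ρ ^ j * D j ω, fun ω => ?_, hai.const_mul _, ?_⟩
  · have : 0 ≤ ∑' j, ρ ^ j * D j ω := tsum_nonneg fun j => mul_nonneg (by positivity) (hD0 j ω)
    positivity
  · filter_upwards [has, hX.continuous_paths] with ω hω hc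
    refine holderBound_of_dyadic_increments hbeta hT (hc.mono Icc_subset_Ici_self)
      (fun j => hD0 j ω) hω fun j i hi => ?_
    refine (le_add_pow_div_pow (abs_nonneg _) (pow_pos hd0 j) q).trans ?_
    simp only [hD]
    gcongr
    exact Finset.single_le_sum (f := fun i : ℕ => |X ((i + 1 : ℕ) * (T / 2 ^ j)) ω -
      X (i * (T / 2 ^ j)) ω| ^ (q + 1)) (fun i _ => by positivity) (Finset.mem_range.2 hi)
end fbm

/-! ### Growth of Hausdorff measure for a deterministic driver -/

section growth
variable {n k : ℕ} {alpha beta T : ℝ}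
  {U : Fin k → EuclideanSpace ℝ (Fin n) → EuclideanSpace ℝ (Fin n)} {M0 M1 M2 : Fin k → ℝ}
  {b : Fin k → ℝ → ℝ} {l : Fin k → ℝ}

/-- Number of steps needed so that the driver is small on each of them. -/
lemma exists_step_count (hbeta : 0 < beta) (hT : 0 < T) {R : ℝ} (hR : 0 ≤ R) :
    ∃ N : ℕ, 0 < N ∧ R * (T / N) ^ beta ≤ 1 ∧ (N : ℝ) ≤ T * R ^ (1 / beta) + 2 := by
  have h0 : 0 ≤ T * R ^ (1 / beta) := by positivity
  refine ⟨⌈T * R ^ (1 / beta)⌉₊ + 1, Nat.succ_pos _, ?_, ?_⟩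
  · have hN : T * R ^ (1 / beta) ≤ (⌈T * R ^ (1 / beta)⌉₊ + 1 : ℕ) := by
      push_cast; linarith [Nat.le_ceil (T * R ^ (1 / beta))]
    set N := ⌈T * R ^ (1 / beta)⌉₊ + 1
    have hN0 : (0 : ℝ) < N := Nat.cast_pos.2 (Nat.succ_pos _)
    have h1 : T / N * R ^ (1 / beta) ≤ 1 := by
      rw [div_mul_eq_mul_div, div_le_one hN0]; exact hN
    have h2 := Real.rpow_le_rpow (by positivity) h1 hbeta.le
    rwa [Real.mul_rpow (by positivity) (by positivity), ← Real.rpow_mul hR,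
      one_div_mul_cancel hbeta.ne', Real.rpow_one, Real.one_rpow, mul_comm] at h2
  · push_cast
    linarith [Nat.ceil_lt_add_one h0]

/-- Growth of Hausdorff measures under the flow of a Young differential equation. -/
lemma IsDrivenFlow.hausdorffMeasure_image_le (h0 : 0 < alpha) (h1 : alpha < 1 / 2)
    (hab : 1 < alpha + beta) (hU : VectorFieldBounds U M0 M1 M2) {m : ℝ} (hm : 0 ≤ m)
    (hM0 : ∀ γ, M0 γ ≤ m) (hM1 : ∀ γ, M1 γ ≤ m) (hM2 : ∀ γ, M2 γ ≤ m) (hl : ∀ γ, 0 ≤ l γ)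
    (hb : ∀ γ, HolderBound (l γ) beta 0 T (b γ)) (hT : 0 < T) {c Q : ℝ}
    (hc : c = youngConst alpha (1 - alpha) beta)
    (hQ : Q = 1 + 2 * (n * m * (1 + c + 4 * c * n ^ 2 * m)))
    {Φ : ℝ → EuclideanSpace ℝ (Fin n) → EuclideanSpace ℝ (Fin n)}
    (hΦ : IsDrivenFlow alpha T U b Φ) {t : ℝ} (ht : t ∈ Icc 0 T) {d : ℕ} (hd : d ≤ n)
    (S : Set (EuclideanSpace ℝ (Fin n))) :
    μH[(d : ℝ)] (Φ t '' S) ≤ ENNReal.ofReal (4 ^ n) * μH[(d : ℝ)] S *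
      ENNReal.ofReal ((2 : ℝ) ^ (n * (Q * ∑ γ, l γ) ^ (1 / beta) * T)) := by
  have hbeta : 0 < beta := by linarith
  have hc0 : 0 < c := hc ▸ youngConst_pos h0 (by linarith) (by linarith) (by linarith)
  have hL : 0 ≤ ∑ γ, l γ := Finset.sum_nonneg fun γ _ => hl γ
  have hA : 0 ≤ n * m * (1 + c + 4 * c * n ^ 2 * m) := by positivity
  have hQ0 : 0 ≤ Q := by rw [hQ]; positivity
  -- Since `Q = 1 + 2 * A`, the single condition `Q * L * (T / N) ^ beta ≤ 1` yields both smallness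
  -- conditions, `≤ 1` for the driver and `≤ 1 / 2` after multiplication by `A`.
  obtain ⟨N, hN0, hN1, hN2⟩ := exists_step_count hbeta hT (mul_nonneg hQ0 hL)
  have hq0 : 0 ≤ (∑ γ, l γ) * (T / N) ^ beta := by positivity
  rw [mul_assoc, hQ, add_mul, one_mul, mul_assoc] at hN1
  have hAq := mul_nonneg hA hq0
  have hlip : LipschitzWith (2 ^ N) (Φ t) := LipschitzWith.of_dist_le_mul fun x y => by
    rw [dist_eq_norm, dist_eq_norm]
    have := (hΦ.isDrivenPath x).norm_sub_le_two_pow h0 h1 hab hU hm hM0 hM1 hM2 hl hb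
      (hΦ.isDrivenPath y) hT hN0 hc (by linarith) (by linarith) ht
    simpa using this
  refine (hlip.hausdorffMeasure_image_le (Nat.cast_nonneg d) S).trans ?_
  rw [mul_right_comm, ← ENNReal.ofReal_mul (by positivity)]
  gcongr
  rw [ENNReal.rpow_natCast, ← ENNReal.ofReal_coe_nnreal, ← ENNReal.ofReal_pow (by positivity)]
  refine ENNReal.ofReal_le_ofReal ?_
  push_cast
  -- The additive `2` in the bound on `N` becomes the prefactor `4 ^ n`.
  calc ((2 : ℝ) ^ N) ^ d ≤ (2 ^ N) ^ n := pow_le_pow_right₀ (one_le_pow₀ (by norm_num)) hd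
    _ = 2 ^ ((N : ℝ) * n) := by rw [← pow_mul, ← Real.rpow_natCast]; push_cast; rfl
    _ ≤ 2 ^ ((2 : ℝ) * n + n * (Q * ∑ γ, l γ) ^ (1 / beta) * T) := by
        refine Real.rpow_le_rpow_of_exponent_le (by norm_num) ?_
        have := mul_le_mul_of_nonneg_right hN2 (Nat.cast_nonneg (α := ℝ) n)
        linarith
    _ = _ := by
        rw [Real.rpow_add (by norm_num), Real.rpow_mul (by norm_num), Real.rpow_natCast]
        norm_num
end growth

/-! ### Hölder bounds of a vector path and of its coordinates -/

section vectorHolderNorm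
variable {k : ℕ} {beta T : ℝ} {f : Fin k → ℝ → ℝ}

lemma HolderBound.toLp {K : Fin k → ℝ} (hf : ∀ γ, HolderBound (K γ) beta 0 T (f γ)) :
    HolderBound (∑ γ, K γ) beta 0 T
      (fun t => (WithLp.toLp 2 (fun γ => f γ t) : EuclideanSpace ℝ (Fin k))) := by
  intro u hu v hv
  rw [← EuclideanSpace.sum_smul_single (WithLp.toLp 2 (fun γ => f γ u) - _)]
  refine (norm_sum_le _ _).trans ?_
  rw [Finset.sum_mul]
  refine Finset.sum_le_sum fun γ _ => ?_
  rw [norm_smul, PiLp.norm_single, norm_one, mul_one]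
  exact hf γ u hu v hv

lemma HolderBound.of_toLp {K : ℝ} (hf : HolderBound K beta 0 T
      (fun t => (WithLp.toLp 2 (fun γ => f γ t) : EuclideanSpace ℝ (Fin k)))) (γ : Fin k) :
    HolderBound K beta 0 T (f γ) := fun u hu v hv =>
  (EuclideanSpace.abs_apply_le (WithLp.toLp 2 (fun γ => f γ u) - WithLp.toLp 2 (fun γ => f γ v))
    γ).trans (hf u hu v hv)
end vectorHolderNorm

end

theorem theorem3p2 (n k : ℕ) (alpha beta : ℝ) (halpha : alpha < 1 / 2)
    (halphabeta : 1 < alpha + beta) (M0 M1 M2 : Fin k → ℝ) :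
    -- `c₁`, `C₁` and the function `F` giving `C_{1,T} = F ((‖B_γ‖_{beta,T})_γ)` depend only on
    -- `alpha, beta, n, k, M0, M1, M2`
    ∃ (c₁ C₁ : ℝ) (F : (Fin k → ℝ) → ℝ), 0 < c₁ ∧ 0 < C₁ ∧ Measurable F ∧ (∀ h, 0 ≤ F h) ∧
      ∀ (H T : ℝ), 1 / 2 < H → H < 1 → 1 - H < alpha → beta < H → 0 < T →
      ∀ {Ω : Type*} [MeasurableSpace Ω] (P : Measure Ω) [IsProbabilityMeasure P]
        (B : Fin k → ℝ → Ω → ℝ),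
      (∀ γ, IsFractionalBrownianMotion H (B γ) P) →
      iIndepFun (fun γ ω (t : ℝ≥0) => B γ t ω) P →
      ∀ C : Ω → ℝ, (∀ ω, C ω = F (fun γ => holderNorm beta 0 T (fun t => B γ t ω))) →
      -- growth of the Hausdorff measure
      (∀ (U : Fin k → EuclideanSpace ℝ (Fin n) → EuclideanSpace ℝ (Fin n)),
        VectorFieldBounds U M0 M1 M2 →
        ∀ (Φ : Ω → ℝ → EuclideanSpace ℝ (Fin n) → EuclideanSpace ℝ (Fin n)),
        (∀ᵐ ω ∂P, IsDrivenFlow alpha T U (fun γ t => B γ t ω) (Φ ω)) →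
        ∀ (m : ℕ) (M : Set (EuclideanSpace ℝ (Fin n))), IsC2Submanifold m M →
        ∀ᵐ ω ∂P, (⨆ t ∈ Icc (0 : ℝ) T, μH[(m : ℝ)] (Φ ω t '' M)) ≤
          ENNReal.ofReal c₁ * μH[(m : ℝ)] M * ENNReal.ofReal ((2 : ℝ) ^ (C ω * T))) ∧
      -- moment bound
      AEMeasurable C P ∧ Integrable (fun ω => C ω ^ beta) P ∧
      Integrable (fun ω => holderNorm beta 0 T
        (fun t => (WithLp.toLp 2 (fun γ => B γ t ω) : EuclideanSpace ℝ (Fin k)))) P ∧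
      ∫ ω, C ω ^ beta ∂P ≤ C₁ * ∫ ω, holderNorm beta 0 T
        (fun t => (WithLp.toLp 2 (fun γ => B γ t ω) : EuclideanSpace ℝ (Fin k))) ∂P := by
  -- The constants precede `H`, so this case must be given some; it is vacuous because `0 < 1 - H <
  -- alpha`.
  rcases le_or_gt alpha 0 with h0 | h0
  · refine ⟨1, 1, 0, one_pos, one_pos, measurable_const, fun _ => le_rfl, ?_⟩
    intro H T _ hH1 hHa
    linarith
  have hbeta : 0 < beta := by linarith
  set μ : ℝ := ∑ γ, |M0 γ| + ∑ γ, |M1 γ| + ∑ γ, |M2 γ| with hμ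
  have hs0 : 0 ≤ ∑ γ, |M0 γ| := Finset.sum_nonneg fun _ _ => abs_nonneg _
  have hs1 : 0 ≤ ∑ γ, |M1 γ| := Finset.sum_nonneg fun _ _ => abs_nonneg _
  have hs2 : 0 ≤ ∑ γ, |M2 γ| := Finset.sum_nonneg fun _ _ => abs_nonneg _
  have hsingle : ∀ (M : Fin k → ℝ) γ, M γ ≤ ∑ γ, |M γ| := fun M γ => (le_abs_self _).trans
    (Finset.single_le_sum (f := fun γ => |M γ|) (fun _ _ => abs_nonneg _) (Finset.mem_univ γ))
  have hμ0 : 0 ≤ μ := by positivity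
  obtain ⟨c, hc⟩ : ∃ c, c = youngConst alpha (1 - alpha) beta := ⟨_, rfl⟩
  have hc0 : 0 < c := hc ▸ youngConst_pos h0 (by linarith) (by linarith) (by linarith)
  obtain ⟨Q, hQ⟩ : ∃ Q : ℝ, Q = 1 + 2 * (n * μ * (1 + c + 4 * c * n ^ 2 * μ)) := ⟨_, rfl⟩
  have hQ0 : 0 ≤ Q := by rw [hQ]; positivity
  -- The absolute values keep the base nonnegative for every argument of `F`, and `+ 1` keeps `C₁`
  -- positive when the main term vanishes.
  refine ⟨4 ^ n, (n : ℝ) ^ beta * Q * k + 1, fun h => n * (Q * ∑ γ, |h γ|) ^ (1 / beta),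
    by positivity, by positivity, by fun_prop, fun h => by positivity, ?_⟩
  intro H T _ _ _ hbH hT Ω _ P _ B hB _ C hC
  set N : Fin k → Ω → ℝ := fun γ ω => holderNorm beta 0 T (fun t => B γ t ω) with hN
  set V : Ω → ℝ := fun ω => holderNorm beta 0 T
    (fun t => (WithLp.toLp 2 (fun γ => B γ t ω) : EuclideanSpace ℝ (Fin k))) with hV
  have hN0 : ∀ γ ω, 0 ≤ N γ ω := fun _ _ => holderNorm_nonneg
  have hCN : ∀ ω, C ω = n * (Q * ∑ γ, N γ ω) ^ (1 / beta) := fun ω => by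
    rw [hC ω]
    simp only [hN, abs_of_nonneg holderNorm_nonneg]
  choose S hS0 hSi hSb using fun γ => (hB γ).exists_integrable_holderBound hbeta hbH hT
  have hSall := ae_all_iff.2 hSb
  have hbdd : ∀ᵐ ω ∂P, ∀ γ, BddAbove (holderQuotients beta 0 T fun t => B γ t ω) := by
    filter_upwards [hSall] with ω hω γ using (hω γ).bddAbove (hS0 γ ω)
  have hBm : ∀ γ, ∀ t ∈ Icc 0 T, AEStronglyMeasurable (B γ t) P := fun γ t ht =>
    ((hB γ).hasGaussianLaw ht.1).aemeasurable.aestronglyMeasurable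
  have hNm : ∀ γ, AEMeasurable (N γ) P := fun γ =>
    aemeasurable_holderNorm hbeta hT.le (hBm γ)
      ((hB γ).continuous_paths.mono fun ω hω => hω.mono Icc_subset_Ici_self)
      (hbdd.mono fun ω hω => hω γ)
  have hNi : ∀ γ, Integrable (N γ) P := fun γ =>
    (hSi γ).mono' (hNm γ).aestronglyMeasurable (by
      filter_upwards [hSb γ] with ω hω
      rw [Real.norm_of_nonneg (hN0 γ ω)]
      exact hω.holderNorm_le (hS0 γ ω))
  have hVbdd : ∀ᵐ ω ∂P, BddAbove (holderQuotients beta 0 T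
      fun t => (WithLp.toLp 2 (fun γ => B γ t ω) : EuclideanSpace ℝ (Fin k))) := by
    filter_upwards [hSall] with ω hω
    exact (HolderBound.toLp hω).bddAbove (Finset.sum_nonneg fun γ _ => hS0 γ ω)
  have hVm : AEMeasurable V P := by
    refine aemeasurable_holderNorm
      (X := fun t ω => (WithLp.toLp 2 (fun γ => B γ t ω) : EuclideanSpace ℝ (Fin k)))
      hbeta hT.le (fun t ht => ?_) ?_ hVbdd
    · exact (PiLp.continuous_toLp 2 _).comp_aestronglyMeasurable
        (aemeasurable_pi_lambda _ fun γ => (hBm γ t ht).aemeasurable).aestronglyMeasurable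
    · filter_upwards [ae_all_iff.2 fun γ => (hB γ).continuous_paths] with ω hω
      exact (PiLp.continuous_toLp 2 _).comp_continuousOn
        (continuousOn_pi.2 fun γ => (hω γ).mono Icc_subset_Ici_self)
  have hVi : Integrable V P := by
    refine (integrable_finsetSum Finset.univ fun γ _ => hSi γ).mono' hVm.aestronglyMeasurable ?_
    filter_upwards [hSall] with ω hω
    rw [Real.norm_of_nonneg holderNorm_nonneg]
    exact (HolderBound.toLp hω).holderNorm_le (Finset.sum_nonneg fun γ _ => hS0 γ ω)
  have hNV : ∀ γ, ∀ᵐ ω ∂P, N γ ω ≤ V ω := fun γ => by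
    filter_upwards [hVbdd] with ω hω
    exact ((holderBound_holderNorm hω).of_toLp γ).holderNorm_le holderNorm_nonneg
  -- The exponent `1 / beta` cancels, so only first moments of the Hölder norms are needed.
  have hCb : ∀ ω, C ω ^ beta = (n : ℝ) ^ beta * Q * ∑ γ, N γ ω := fun ω => by
    have h1 : 0 ≤ Q * ∑ γ, N γ ω := mul_nonneg hQ0 (Finset.sum_nonneg fun γ _ => hN0 γ ω)
    rw [hCN, Real.mul_rpow (by positivity) (by positivity), ← Real.rpow_mul h1,
      one_div_mul_cancel hbeta.ne', Real.rpow_one, mul_assoc]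
  have hsi : Integrable (fun ω => ∑ γ, N γ ω) P :=
    integrable_finsetSum Finset.univ fun γ _ => hNi γ
  refine ⟨?_, ?_, ?_, hVi, ?_⟩
  · intro U hU Φ hΦ m M hM
    filter_upwards [hΦ, hbdd] with ω hω hbω
    refine iSup₂_le fun t ht => ?_
    rw [hCN]
    exact hω.hausdorffMeasure_image_le h0 halpha halphabeta hU hμ0
      (fun γ => by linarith [hsingle M0 γ]) (fun γ => by linarith [hsingle M1 γ])
      (fun γ => by linarith [hsingle M2 γ]) (fun γ => hN0 γ ω)
      (fun γ => holderBound_holderNorm (hbω γ)) hT hc hQ ht hM.1 M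
  · rw [show C = fun ω => n * (Q * ∑ γ, N γ ω) ^ (1 / beta) from funext hCN]
    fun_prop
  · simp only [hCb]
    exact hsi.const_mul _
  · simp only [hCb]
    rw [integral_const_mul, integral_finsetSum _ fun γ _ => hNi γ]
    have hVnn : 0 ≤ ∫ ω, V ω ∂P := integral_nonneg fun ω => holderNorm_nonneg
    have hsum : ∑ γ, ∫ ω, N γ ω ∂P ≤ k * ∫ ω, V ω ∂P := by
      refine (Finset.sum_le_sum fun γ _ => integral_mono_ae (hNi γ) hVi (hNV γ)).trans ?_
      simp
    have := mul_le_mul_of_nonneg_left hsum (show 0 ≤ (n : ℝ) ^ beta * Q by positivity)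
    linarith
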